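/- Let $A$ be a symmetric monoidal category that is locally presentable, and assume that for every object $X$ of $A$ the functors $X\otimes(-)$ and $(-)\otimes X$ preserve (small) directed colimits. Let $\mathbf{Mon}^{\mathrm{com}}_A$ be the category of commutative monoids in $A$ with respect to $\otimes$, in which finite coproducts are given by the tensor product and the unit object, and let $$\mathbf{Hopf}^{\mathrm{com}}_A := \mathrm{Grp}\bigl((\mathbf{Mon}^{\mathrm{com}}_A)^{\mathrm{op}}\bigr)^{\mathrm{op}}$$ be the category of commutative Hopf algebras in $A$, i.e. of internal cogroups in $\mathbf{Mon}^{\mathrm{com}}_A$. Then: 1. $\mathbf{Hopf}^{\mathrm{com}}_A$ is locally presentable; 2. $\mathbf{Hopf}^{\mathrm{com}}_A$ is pointed, i.e. it has an object that is both initial and terminal; 3. $\mathbf{Hopf}^{\mathrm{com}}_A$ is coprotomodular, i.e. $C:=(\mathbf{Hopf}^{\mathrm{com}}_A)^{\mathrm{op}}$ is protomodular: in $C$, pullbacks along retractions exist, and for every retraction $r\colon x\to y$ with a section $s$ ($rs=\mathrm{id}_y$), every morphism $f\colon b\to y$, and every pullback of $f$ along $r$, with projection $k\colon a\to x$, the pair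 $(s,k)$ is jointly extremal epimorphic, i.e. every monomorphism $m$ with codomain $x$ through which both $s$ and $k$ factor is an isomorphism. -/

import Mathlib

open CategoryTheory MonoidalCategory Limits Opposite
open scoped MonObj

universe v u

namespace CommMonCoproduct

section Objects

variable {A : Type u} [Category.{v} A] [MonoidalCategory A]

theorem isMonHom_one (X : A) [MonObj X] : IsMonHom η[X] :=
  ⟨by simp, by simp [← MonoidalCategory.unitors_equal]⟩

theorem inl_desc {X Y Z : A} [MonObj Y] [MonObj Z] (f : X ⟶ Z) (g : Y ⟶ Z) [IsMonHom g] :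
    ((ρ_ X).inv ≫ X ◁ η[Y]) ≫ (f ⊗ₘ g) ≫ μ[Z] = f := by
  have h : X ◁ η[Y] ≫ (f ⊗ₘ g) = f ▷ 𝟙_ A ≫ Z ◁ η[Z] := by
    rw [MonoidalCategory.tensorHom_def', ← MonoidalCategory.whiskerLeft_comp_assoc,
      IsMonHom.one_hom, whisker_exchange]
  rw [Category.assoc, reassoc_of% h]
  simp

theorem inr_desc {X Y Z : A} [MonObj X] [MonObj Z] (f : X ⟶ Z) (g : Y ⟶ Z) [IsMonHom f] :
    ((λ_ Y).inv ≫ η[X] ▷ Y) ≫ (f ⊗ₘ g) ≫ μ[Z] = g := by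
  have h : η[X] ▷ Y ≫ (f ⊗ₘ g) = 𝟙_ A ◁ g ≫ η[Z] ▷ Z := by
    rw [MonoidalCategory.tensorHom_def, ← MonoidalCategory.comp_whiskerRight_assoc,
      IsMonHom.one_hom, whisker_exchange]
  rw [Category.assoc, reassoc_of% h]
  simp

variable [BraidedCategory A]

theorem isMonHom_inl (X Y : A) [MonObj X] [MonObj Y] :
    IsMonHom ((ρ_ X).inv ≫ X ◁ η[Y]) := by
  have := isMonHom_one Y
  have : IsMonHom (ρ_ X).inv := inferInstance
  have : IsMonHom (X ◁ η[Y]) := inferInstance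
  exact instIsMonHomComp _ _

theorem isMonHom_inr (X Y : A) [MonObj X] [MonObj Y] :
    IsMonHom ((λ_ Y).inv ≫ η[X] ▷ Y) := by
  have := isMonHom_one X
  have : IsMonHom (λ_ Y).inv := inferInstance
  have : IsMonHom (η[X] ▷ Y) := inferInstance
  exact instIsMonHomComp _ _

theorem isMonHom_mul (Z : A) [MonObj Z] [IsCommMonObj Z] : IsMonHom μ[Z] where
  one_hom := by simp [MonObj.tensorObj.one_def, ← MonoidalCategory.unitors_equal]
  mul_hom := by simp [MonObj.tensorObj.mul_def]

theorem isMonHom_desc {X Y Z : A} [MonObj X] [MonObj Y] [MonObj Z] [IsCommMonObj Z]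
    (f : X ⟶ Z) (g : Y ⟶ Z) [IsMonHom f] [IsMonHom g] : IsMonHom ((f ⊗ₘ g) ≫ μ[Z]) := by
  have := isMonHom_mul Z
  exact instIsMonHomComp _ _

theorem inl_mul_inr (X Y : A) [MonObj X] [MonObj Y] :
    (((ρ_ X).inv ≫ X ◁ η[Y]) ⊗ₘ ((λ_ Y).inv ≫ η[X] ▷ Y)) ≫ μ[X ⊗ Y] = 𝟙 (X ⊗ Y) := by
  have h := tensorμ_natural (𝟙 X) η[Y] η[X] (𝟙 Y)
  simp only [id_tensorHom, tensorHom_id] at h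
  have h' : ((ρ_ X).inv ⊗ₘ (λ_ Y).inv) ≫ tensorμ X (𝟙_ A) (𝟙_ A) Y =
      (ρ_ X).inv ⊗ₘ (λ_ Y).inv := by
    simp only [tensorμ, braiding_tensorUnit_left]
    monoidal
  rw [MonObj.tensorObj.mul_def, ← tensorHom_comp_tensorHom, Category.assoc, reassoc_of% h,
    reassoc_of% h', tensorHom_comp_tensorHom, tensorHom_comp_tensorHom]
  simp

end Objects

variable {A : Type u} [Category.{v} A] [MonoidalCategory A] [SymmetricCategory A]

/-- The tensor product of two commutative monoids. -/
abbrev tensor (X Y : CommMon A) : CommMon A := ⟨X.X ⊗ Y.X⟩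

/-- The first coprojection `x ↦ x ⊗ 1`. -/
def inl (X Y : CommMon A) : X ⟶ tensor X Y :=
  CommMon.homMk (Mon.Hom.mk (M := X.toMon) (N := (tensor X Y).toMon)
    ((ρ_ X.X).inv ≫ X.X ◁ η[Y.X]) (isMonHom_hom := isMonHom_inl X.X Y.X))

/-- The second coprojection `y ↦ 1 ⊗ y`. -/
def inr (X Y : CommMon A) : Y ⟶ tensor X Y :=
  CommMon.homMk (Mon.Hom.mk (M := Y.toMon) (N := (tensor X Y).toMon)
    ((λ_ Y.X).inv ≫ η[X.X] ▷ Y.X) (isMonHom_hom := isMonHom_inr X.X Y.X))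

/-- The copairing `x ⊗ y ↦ f x * g y`. -/
def desc {X Y Z : CommMon A} (f : X ⟶ Z) (g : Y ⟶ Z) : tensor X Y ⟶ Z :=
  CommMon.homMk (Mon.Hom.mk (M := (tensor X Y).toMon) (N := Z.toMon)
    (((show X.X ⟶ Z.X from f.hom.hom) ⊗ₘ (show Y.X ⟶ Z.X from g.hom.hom)) ≫ μ[Z.X])
    (isMonHom_hom :=
      have : IsMonHom (show X.X ⟶ Z.X from f.hom.hom) := f.hom.isMonHom_hom
      have : IsMonHom (show Y.X ⟶ Z.X from g.hom.hom) := g.hom.isMonHom_hom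
      isMonHom_desc (show X.X ⟶ Z.X from f.hom.hom) (show Y.X ⟶ Z.X from g.hom.hom)))

theorem inl_comp_desc {X Y Z : CommMon A} (f : X ⟶ Z) (g : Y ⟶ Z) : inl X Y ≫ desc f g = f :=
  have : IsMonHom (show Y.X ⟶ Z.X from g.hom.hom) := g.hom.isMonHom_hom
  CommMon.hom_ext _ _ (inl_desc (X := X.X) (Y := Y.X) (Z := Z.X) f.hom.hom g.hom.hom)

theorem inr_comp_desc {X Y Z : CommMon A} (f : X ⟶ Z) (g : Y ⟶ Z) : inr X Y ≫ desc f g = g :=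
  have : IsMonHom (show X.X ⟶ Z.X from f.hom.hom) := f.hom.isMonHom_hom
  CommMon.hom_ext _ _ (inr_desc (X := X.X) (Y := Y.X) (Z := Z.X) f.hom.hom g.hom.hom)

theorem desc_inl_inr {X Y Z : CommMon A} (f : tensor X Y ⟶ Z) :
    desc (inl X Y ≫ f) (inr X Y ≫ f) = f := by
  apply CommMon.hom_ext
  have h := inl_mul_inr X.X Y.X
  have hf := f.hom.isMonHom_hom.mul_hom
  calc _ = ((((ρ_ X.X).inv ≫ X.X ◁ η[Y.X]) ≫ (show X.X ⊗ Y.X ⟶ Z.X from f.hom.hom)) ⊗ₘ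
        (((λ_ Y.X).inv ≫ η[X.X] ▷ Y.X) ≫ (show X.X ⊗ Y.X ⟶ Z.X from f.hom.hom))) ≫ μ[Z.X] := rfl
    _ = ((((ρ_ X.X).inv ≫ X.X ◁ η[Y.X]) ⊗ₘ ((λ_ Y.X).inv ≫ η[X.X] ▷ Y.X)) ≫ μ[X.X ⊗ Y.X]) ≫
        (show X.X ⊗ Y.X ⟶ Z.X from f.hom.hom) := by
      rw [← tensorHom_comp_tensorHom, Category.assoc, Category.assoc]
      exact congrArg _ hf.symm
    _ = _ := by rw [h]; exact Category.id_comp _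

theorem hom_ext {X Y Z : CommMon A} {f g : tensor X Y ⟶ Z} (h₁ : inl X Y ≫ f = inl X Y ≫ g)
    (h₂ : inr X Y ≫ f = inr X Y ≫ g) : f = g := by
  rw [← desc_inl_inr f, ← desc_inl_inr g, h₁, h₂]

/-- The tensor product, seen in the opposite category, as a binary product. -/
def limitCone (X Y : (CommMon A)ᵒᵖ) : LimitCone (pair X Y) where
  cone := BinaryFan.mk (P := op (tensor X.unop Y.unop)) (inl X.unop Y.unop).op
    (inr X.unop Y.unop).op
  isLimit := BinaryFan.isLimitMk (fun s => (desc s.fst.unop s.snd.unop).op)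
    (fun _ => Quiver.Hom.unop_inj (inl_comp_desc _ _))
    (fun _ => Quiver.Hom.unop_inj (inr_comp_desc _ _))
    (fun _ _ h₁ h₂ => Quiver.Hom.unop_inj (hom_ext
      ((congrArg Quiver.Hom.unop h₁).trans (inl_comp_desc _ _).symm)
      ((congrArg Quiver.Hom.unop h₂).trans (inr_comp_desc _ _).symm)))

/-- The tensor unit, seen in the opposite category, as a terminal object. -/
def terminalCone : LimitCone (Functor.empty.{0} (CommMon A)ᵒᵖ) where
  cone := asEmptyCone (op (CommMon.trivial A))
  isLimit := IsTerminal.ofUniqueHom (fun X => (default : CommMon.trivial A ⟶ X.unop).op)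
    (fun _ _ => Quiver.Hom.unop_inj (Subsingleton.elim _ _))

end CommMonCoproduct

/-- The opposite of the category of commutative monoids in a symmetric monoidal category has finite
products, given by the tensor product of the monoidal category: the product of `op X` and `op Y`
is `op (X ⊗ Y)` and the terminal object is `op (𝟙_ A)`. -/
instance cartesianMonoidalOp (A : Type u) [Category.{v} A] [MonoidalCategory A]
    [SymmetricCategory A] : CartesianMonoidalCategory (CommMon A)ᵒᵖ :=
  .ofChosenFiniteProducts CommMonCoproduct.terminalCone CommMonCoproduct.limitCone

/-- The category of commutative Hopf algebras in a symmetric monoidal category `A`: the category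
of internal cogroups in the category of commutative monoids in `A`, that is, the opposite of the
category of internal groups in `(CommMon A)ᵒᵖ`. -/
abbrev CommHopf (A : Type u) [Category.{v} A] [MonoidalCategory A] [SymmetricCategory A] :
    Type (max u v) :=
  (Grp (CommMon A)ᵒᵖ)ᵒᵖ

/-- A pair of morphisms with the same codomain is jointly extremal epimorphic if any monomorphism
through which both of them factor is an isomorphism. -/
def JointlyExtremalEpic {C : Type u} [Category.{v} C] {X Y Z : C} (f : X ⟶ Z) (g : Y ⟶ Z) : Prop :=
  ∀ ⦃W : C⦄ (m : W ⟶ Z) (f' : X ⟶ W) (g' : Y ⟶ W), Mono m → f' ≫ m = f → g' ≫ m = g → IsIso m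

/-- A category is protomodular if pullbacks along retractions exist and, for every retraction
`r : X ⟶ Y` with section `s` and every pullback `k : P ⟶ X` along `r` of a morphism `f : B ⟶ Y`,
the pair `(s, k)` is jointly extremal epimorphic. -/
structure IsProtomodular (C : Type u) [Category.{v} C] : Prop where
  hasPullback : ∀ ⦃X Y B : C⦄ (r : X ⟶ Y) (s : Y ⟶ X) (f : B ⟶ Y), s ≫ r = 𝟙 Y → HasPullback r f
  jointlyExtremalEpic : ∀ ⦃X Y B P : C⦄ (r : X ⟶ Y) (s : Y ⟶ X) (f : B ⟶ Y) (k : P ⟶ X)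
    (t : P ⟶ B), s ≫ r = 𝟙 Y → IsPullback k t r f → JointlyExtremalEpic s k

/-- A functor between categories with hom-sets in `Type v` preserves directed colimits if it
preserves the colimits of all diagrams indexed by a `v`-small nonempty directed poset. -/
def PreservesDirectedColimits {C D : Type u} [Category.{v} C] [Category.{v} D] (F : C ⥤ D) :
    Prop :=
  ∀ (J : Type v) [PartialOrder J] [IsDirectedOrder J] [Nonempty J], PreservesColimitsOfShape J F

/-!
Commutative monoids in `A` are the objects `X` with operations `𝟙_ A ⟶ X` and `X ⊗ X ⟶ X` which
satisfy finitely many equations, and the arities `X ↦ 𝟙_ A` and `X ↦ X ⊗ X` preserve filtered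
colimits and `κ`-presentable objects, for all sufficiently large regular cardinals `κ`. Dually, a
cogroup is given by operations from `X` to the initial object, to `X ⨿ X` and to `X`. Both are
*dialgebras*, namely families of morphisms `F i X ⟶ G i X`, satisfying equations.

Let `X` be such a dialgebra, written as a `κ`-filtered colimit of `κ`-presentable objects `D t`. The
operations and the equations lift to maps from a `D t` to some `D t'`. A countable iteration closes
any `κ`-small set of indices, with `κ > ℵ₀`, to a `κ`-small directed set `B` which contains all the
`t'` involved, and the colimit of `D` over `B` is then a `κ`-presentable object over `X` to which
the operations restrict and in which the equations hold. These objects are therefore cofinal among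
the `κ`-presentable objects over `X`, and the category of dialgebras is `κ`-accessible.
Cogroups have colimits because internal groups have limits. Commutative monoids have limits, and a
category with limits which is `κ`-accessible for arbitrarily large `κ` also has colimits, by the
adjoint functor theorem.

In the category of internal groups, the trivial group is a zero object, and protomodularity is the
formula `x = (x / s (r x)) * s (r x)`.
-/

universe w u'

section Absorption

variable {𝒜 : Type*} [Category* 𝒜] {ℬ : Type*} [Category* ℬ]

/-- A functor `Φ : 𝒜 ⥤ ℬ` is `κ`-absorbing if every `κ`-small family of morphisms `Φ Y k ⟶ P` in `ℬ`
is carried, by some morphism from `P` to the image of an object of `𝒜`, to the image of a family of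
morphisms of `𝒜`. -/
def IsAbsorbing (Φ : 𝒜 ⥤ ℬ) (κ : Cardinal.{w}) : Prop :=
  ∀ ⦃K : Type w⦄ (_ : HasCardinalLT K κ) (Y : K → 𝒜) ⦃P : ℬ⦄ (g : ∀ k, Φ.obj (Y k) ⟶ P),
    ∃ (Z : 𝒜) (q : P ⟶ Φ.obj Z) (t : ∀ k, Y k ⟶ Z), ∀ k, g k ≫ q = Φ.map (t k)

namespace IsAbsorbing

variable {Φ : 𝒜 ⥤ ℬ} {κ : Cardinal.{w}} [Fact κ.IsRegular] (hΦ : IsAbsorbing Φ κ)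

include hΦ

theorem exists_hom (P : ℬ) : ∃ Z, Nonempty (P ⟶ Φ.obj Z) := by
  obtain ⟨Z, q, -⟩ := hΦ (K := PEmpty)
    (hasCardinalLT_of_finite _ _ (Cardinal.IsRegular.aleph0_le Fact.out)) PEmpty.elim
    (P := P) fun k => k.elim
  exact ⟨Z, ⟨q⟩⟩

theorem exists_map_eq_comp {Y : 𝒜} {P : ℬ} (g : Φ.obj Y ⟶ P) :
    ∃ (Z : 𝒜) (q : P ⟶ Φ.obj Z) (t : Y ⟶ Z), g ≫ q = Φ.map t := by
  obtain ⟨Z, q, t, h⟩ := hΦ (K := PUnit)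
    (hasCardinalLT_of_finite _ _ (Cardinal.IsRegular.aleph0_le Fact.out)) (fun _ => Y) fun _ => g
  exact ⟨Z, q, t ⟨⟩, h ⟨⟩⟩

variable [IsCardinalFiltered ℬ κ] [Φ.Faithful]

theorem isCardinalFiltered : IsCardinalFiltered 𝒜 κ where
  nonempty_cocone {J} _ F hJ := by
    obtain ⟨c⟩ := IsCardinalFiltered.nonempty_cocone (F ⋙ Φ) hJ
    obtain ⟨Z, q, t, h⟩ := hΦ (hasCardinalLT_of_hasCardinalLT_arrow hJ) F.obj (P := c.pt) c.ι.app
    refine ⟨Z, t, fun i j f => Φ.map_injective ?_⟩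
    have : Φ.map (F.map f) ≫ Φ.map (t j) = Φ.map (t i) := by
      rw [← h, ← h]
      exact c.w_assoc f q
    simpa using this

theorem final : Φ.Final := by
  have := hΦ.isCardinalFiltered
  have := isFiltered_of_isCardinalFiltered 𝒜 κ
  have := isFiltered_of_isCardinalFiltered ℬ κ
  refine Functor.final_of_exists_of_isFiltered _ hΦ.exists_hom fun {P Y} s s' => ?_
  obtain ⟨Z, q, t, ht⟩ := hΦ.exists_map_eq_comp (IsFiltered.coeqHom s s')
  exact ⟨Z, t, by rw [← ht, reassoc_of% IsFiltered.coeq_condition s s']⟩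

end IsAbsorbing

end Absorption

section Accessible

variable {C : Type u} [Category.{v} C] {E : Type u'} [Category.{v} E]

/-- The functor `(Y, f : Y ⟶ X) ↦ (U Y, U f)`, where `Y` runs through the objects whose image by `U`
satisfies `P`. -/
def costructuredArrowComparison (U : E ⥤ C) (P : ObjectProperty C) (X : E) :
    CostructuredArrow (P.inverseImage U).ι X ⥤ CostructuredArrow P.ι (U.obj X) where
  obj Y := CostructuredArrow.mk (S := P.ι) (Y := ⟨U.obj Y.left.obj, Y.left.property⟩)
    (by exact U.map Y.hom)
  map {Y Z} f := CostructuredArrow.homMk (ObjectProperty.homMk (by exact U.map f.left.hom))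
    (by exact (U.map_comp _ _).symm.trans (congrArg U.map (CostructuredArrow.w f)))

instance (U : E ⥤ C) [U.Faithful] (P : ObjectProperty C) (X : E) :
    (costructuredArrowComparison U P X).Faithful where
  map_injective {Y Z f g} h := by
    ext
    exact U.map_injective (by exact congrArg (fun k => k.left.hom) h)

/-- A functor `U : E ⥤ C` has `κ`-presentable enlargements if, for every object `X` of `E`, any
`κ`-small family of objects over `X` with `κ`-presentable images by `U`, together with any
`κ`-presentable object of `C` between these images and `U.obj X`, is dominated by a single object
over `X` with a `κ`-presentable image. -/
def HasPresentableEnlargements (U : E ⥤ C) (κ : Cardinal.{v}) [Fact κ.IsRegular] : Prop :=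
  ∀ ⦃X : E⦄ ⦃K : Type v⦄ (_ : HasCardinalLT K κ) (Y : K → E)
    (_ : ∀ k, IsCardinalPresentable (U.obj (Y k)) κ) (f : ∀ k, Y k ⟶ X) ⦃P : C⦄
    (_ : IsCardinalPresentable P κ) (p : P ⟶ U.obj X) (g : ∀ k, U.obj (Y k) ⟶ P)
    (_ : ∀ k, g k ≫ p = U.map (f k)),
    ∃ (Z : E) (_ : IsCardinalPresentable (U.obj Z) κ) (h : Z ⟶ X) (q : P ⟶ U.obj Z)
      (t : ∀ k, Y k ⟶ Z), q ≫ U.map h = p ∧ ∀ k, g k ≫ q = U.map (t k)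

namespace HasPresentableEnlargements

variable {U : E ⥤ C} {κ : Cardinal.{v}} [Fact κ.IsRegular] [U.Faithful]
  (hU : HasPresentableEnlargements U κ)

include hU

theorem isAbsorbing (X : E) :
    IsAbsorbing (costructuredArrowComparison U (isCardinalPresentable C κ) X) κ := by
  intro K hK Y P g
  obtain ⟨Z, hZ, h, q, t, hq, ht⟩ := hU hK (fun k => (Y k).left.obj) (fun k => (Y k).left.property)
    (fun k => (Y k).hom) P.left.property P.hom (fun k => (g k).left.hom)
    fun k => by exact CostructuredArrow.w (g k)
  have ht' (k : K) : t k ≫ h = (Y k).hom := U.map_injective (by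
    rw [U.map_comp, ← ht]
    exact (Category.assoc _ _ _).trans ((congrArg _ hq).trans (by exact CostructuredArrow.w (g k))))
  let Z' : CostructuredArrow ((isCardinalPresentable C κ).inverseImage U).ι X :=
    CostructuredArrow.mk (Y := ⟨Z, hZ⟩) (by exact h)
  refine ⟨Z', CostructuredArrow.homMk (ObjectProperty.homMk (by exact q)) (by exact hq),
    fun k => CostructuredArrow.homMk (ObjectProperty.homMk (by exact t k)) (by exact ht' k),
    fun k => ?_⟩
  ext
  exact ht k

variable [IsCardinalAccessibleCategory C κ] [HasCardinalFilteredColimits E κ]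
  [U.IsCardinalAccessible κ] [U.ReflectsIsomorphisms]
  [ObjectProperty.EssentiallySmall.{v} ((isCardinalPresentable C κ).inverseImage U)]

theorem isDense_ι_inverseImage : ((isCardinalPresentable C κ).inverseImage U).ι.IsDense where
  isDenseAt X := by
    let P := isCardinalPresentable C κ
    let J := CostructuredArrow (P.inverseImage U).ι X
    have := (hU.isAbsorbing X).final
    have : IsCardinalFiltered J κ := (hU.isAbsorbing X).isCardinalFiltered
    have := IsCardinalFiltered.of_equivalence κ (equivSmallModel.{v} J)
    have := HasCardinalFilteredColimits.hasColimitsOfShape (κ := κ) E (SmallModel.{v} J)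
    have : HasColimitsOfShape J E := hasColimitsOfShape_of_equivalence (equivSmallModel.{v} J).symm
    have := U.preservesColimitsOfShape_of_isCardinalAccessible_of_essentiallySmall κ J
    have := reflectsColimitsOfShape_of_reflectsIsomorphisms (G := U) (J := J)
    exact ⟨isColimitOfReflects U (IsColimit.ofIsoColimit ((Functor.Final.isColimitWhiskerEquiv
      (costructuredArrowComparison U P X) _).symm (P.ι.denseAt (U.obj X)))
      (Cocone.ext (Iso.refl _) fun j => (Category.comp_id _).trans
        ((Category.id_comp _).trans (congrArg U.map (Category.id_comp _)).symm)))⟩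

theorem isCardinalFilteredGenerator
    (hE : (isCardinalPresentable C κ).inverseImage U ≤ isCardinalPresentable E κ) :
    ((isCardinalPresentable C κ).inverseImage U).IsCardinalFilteredGenerator κ := by
  have (X : E) := (hU.isAbsorbing X).isCardinalFiltered
  have := hU.isDense_ι_inverseImage
  exact IsCardinalFilteredGenerator.of_isDense_ι _ κ hE

variable (hE : (isCardinalPresentable C κ).inverseImage U ≤ isCardinalPresentable E κ)

include hE

theorem isCardinalAccessibleCategory : IsCardinalAccessibleCategory E κ where
  toHasCardinalFilteredGenerator :=
    (hU.isCardinalFilteredGenerator hE).hasCardinalFilteredGenerator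

theorem isCardinalPresentable_obj (X : E) [hX : IsCardinalPresentable X κ] :
    IsCardinalPresentable (U.obj X) κ := by
  rw [← isCardinalPresentable_iff,
    (hU.isCardinalFilteredGenerator hE).isPresentable_eq_retractClosure] at hX
  obtain ⟨Y, hY, ⟨r⟩⟩ := hX
  have : IsCardinalPresentable (U.obj Y) κ := hY
  exact (r.map U).isCardinalPresentable κ

end HasPresentableEnlargements

end Accessible

section Cocomplete

variable {E : Type u} [Category.{v} E]

theorem exists_cardinal_forall_isCardinalPresentable {I : Type*} [Small.{v} I] (X : I → E)
    [∀ i, IsPresentable.{v} (X i)] :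
    ∃ κ₀ : Cardinal.{v}, ∀ (κ : Cardinal.{v}) [Fact κ.IsRegular], κ₀ ≤ κ →
      ∀ i, IsCardinalPresentable (X i) κ := by
  choose κ' _ _ using fun i => Functor.IsAccessible.exists_cardinal (F := coyoneda.obj (op (X i)))
  exact ⟨⨆ i, κ' i, fun κ _ hκ i =>
    isCardinalPresentable_of_le _ ((le_ciSup Cardinal.bddAbove_of_small i).trans hκ)⟩

theorem exists_factorization_of_isCardinalPresentable {J : Type v} [SmallCategory J]
    (κ : Cardinal.{v}) [Fact κ.IsRegular] [IsCardinalAccessibleCategory E κ]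
    (hJ : HasCardinalLT (Arrow J) κ) (D : J ⥤ E) (hD : ∀ j, IsCardinalPresentable (D.obj j) κ)
    (c : Cocone D) :
    ∃ (d : Cocone D) (_ : IsCardinalPresentable d.pt κ), Nonempty (d ⟶ c) := by
  let D' : J ⥤ CostructuredArrow (isCardinalPresentable E κ).ι c.pt :=
    { obj j := CostructuredArrow.mk (Y := ⟨D.obj j, hD j⟩) (by exact c.ι.app j)
      map f := CostructuredArrow.homMk (ObjectProperty.homMk (by exact D.map f)) (by exact c.w f) }
  obtain ⟨d⟩ := IsCardinalFiltered.nonempty_cocone D' hJ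
  exact ⟨((CostructuredArrow.proj _ _ ⋙ ObjectProperty.ι _).mapCocone d), d.pt.left.property,
    ⟨{ hom := d.pt.hom, w j := CostructuredArrow.w (d.ι.app j) }⟩⟩

/-- Accessibility for arbitrarily large cardinals provides the solution set condition for the
existence of colimits. -/
theorem hasColimitsOfSize_of_isCardinalAccessibleCategory [IsAccessibleCategory.{v} E]
    [HasLimitsOfSize.{v, v} E]
    (hE : ∀ κ₀ : Cardinal.{v}, ∃ (κ : Cardinal.{v}) (_ : Fact κ.IsRegular), κ₀ ≤ κ ∧
      IsCardinalAccessibleCategory E κ) :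
    HasColimitsOfSize.{v, v} E := by
  refine ⟨fun J _ => hasColimitsOfShape_iff_isRightAdjoint_const.2
    (isRightAdjoint_of_preservesLimits_of_solutionSetCondition _ fun D => ?_)⟩
  obtain ⟨κ₀, hκ₀⟩ := exists_cardinal_forall_isCardinalPresentable D.obj
  obtain ⟨κ, _, hκ, _⟩ := hE (max (Order.succ (Cardinal.mk (Arrow J))) κ₀)
  obtain ⟨Q, _, -, hQ⟩ := ObjectProperty.EssentiallySmall.exists_small_le.{v}
    (isCardinalPresentable E κ)
  have hJ : HasCardinalLT (Arrow J) κ := by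
    rw [hasCardinalLT_iff_cardinal_mk_lt]
    exact (Order.lt_succ _).trans_le ((le_max_left _ _).trans hκ)
  refine ⟨Σ Y : Shrink.{v} (Subtype Q), D ⟶ (Functor.const J).obj ((equivShrink _).symm Y).1,
    fun i => ((equivShrink _).symm i.1).1, fun i => i.2, fun X c => ?_⟩
  obtain ⟨d, hd, ⟨f⟩⟩ := exists_factorization_of_isCardinalPresentable κ hJ D
    (hκ₀ κ ((le_max_right _ _).trans hκ)) ⟨X, c⟩
  obtain ⟨Z, hZ, ⟨e⟩⟩ := hQ _ hd
  let e' : d.pt ≅ ((equivShrink _).symm (equivShrink (Subtype Q) ⟨Z, hZ⟩)).1 :=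
    e ≪≫ eqToIso (by simp)
  refine ⟨⟨equivShrink _ ⟨Z, hZ⟩, d.ι ≫ (Functor.const J).map e'.hom⟩, e'.inv ≫ f.hom, ?_⟩
  ext j
  simp

theorem isLocallyPresentable_of_isCardinalAccessibleCategory [HasLimitsOfSize.{v, v} E]
    (hE : ∀ κ₀ : Cardinal.{v}, ∃ (κ : Cardinal.{v}) (_ : Fact κ.IsRegular), κ₀ ≤ κ ∧
      IsCardinalAccessibleCategory E κ) :
    IsLocallyPresentable.{v} E := by
  obtain ⟨κ, hκ, -, h⟩ := hE 0
  have : IsAccessibleCategory.{v} E := ⟨κ, hκ, h⟩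
  have := hasColimitsOfSize_of_isCardinalAccessibleCategory hE
  exact ⟨κ, hκ, {}⟩

end Cocomplete

section DirectedSubsets

theorem hasCardinalLT_arrow_of_preorder {κ : Cardinal.{v}} [Fact κ.IsRegular] {T : Type v}
    [Preorder T] (hT : HasCardinalLT T κ) : HasCardinalLT (Arrow T) κ :=
  (hasCardinalLT_prod (Cardinal.IsRegular.aleph0_le Fact.out) hT hT).of_injective
    (fun a : Arrow T => (a.left, a.right)) fun a b h => by
      obtain ⟨a₁, a₂, f⟩ := a
      obtain ⟨b₁, b₂, g⟩ := b
      obtain ⟨rfl, rfl⟩ := Prod.ext_iff.1 h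
      exact congrArg _ (Subsingleton.elim (α := a₁ ⟶ a₂) f g)

theorem exists_hasCardinalLT_superset_closed {T : Type v} {κ : Cardinal.{v}} [Fact κ.IsRegular]
    (hκ : Cardinal.aleph0 < κ) (φ : T → T → Set T) (hφ : ∀ t t', HasCardinalLT (φ t t') κ)
    {S : Set T} (hS : HasCardinalLT S κ) :
    ∃ B : Set T, S ⊆ B ∧ HasCardinalLT B κ ∧ ∀ t ∈ B, ∀ t' ∈ B, φ t t' ⊆ B := by
  let Φ (B : Set T) : Set T := B ∪ ⋃ p : B × B, φ p.1 p.2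
  have hΦ (n : ℕ) : HasCardinalLT (Φ^[n] S) κ := by
    induction n with
    | zero => exact hS
    | succ n hn =>
      rw [Function.iterate_succ_apply']
      exact hasCardinalLT_union hκ.le hn
        (hasCardinalLT_iUnion _ (hasCardinalLT_prod hκ.le hn hn) fun p => hφ _ _)
  have hmono : Monotone fun n => Φ^[n] S := monotone_nat_of_le_succ fun n => by
    rw [Function.iterate_succ_apply']
    exact Set.subset_union_left
  refine ⟨⋃ n, Φ^[n] S, Set.subset_iUnion (fun n => Φ^[n] S) 0,
    hasCardinalLT_iUnion _ (by simpa [HasCardinalLT] using hκ) hΦ, fun t ht t' ht' => ?_⟩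
  obtain ⟨n, hn⟩ := Set.mem_iUnion.1 ht
  obtain ⟨n', hn'⟩ := Set.mem_iUnion.1 ht'
  refine Set.Subset.trans ?_ (Set.subset_iUnion (fun n => Φ^[n] S) (max n n' + 1))
  rw [Function.iterate_succ_apply']
  exact (Set.subset_iUnion (fun p : Φ^[max n n'] S × Φ^[max n n'] S => φ p.1 p.2)
    ⟨⟨t, hmono (le_max_left _ _) hn⟩, ⟨t', hmono (le_max_right _ _) hn'⟩⟩).trans
    Set.subset_union_right

/-- The poset of `κ`-small nonempty directed subsets of a poset `T`. -/
abbrev DirectedSubset (T : Type v) [PartialOrder T] (κ : Cardinal.{v}) : Type v :=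
  { B : Set T // HasCardinalLT B κ ∧ Nonempty B ∧ IsDirectedOrder B }

namespace DirectedSubset

variable {T : Type v} [PartialOrder T] {κ : Cardinal.{v}}

instance (B : DirectedSubset T κ) : Nonempty B.1 := B.2.2.1

instance (B : DirectedSubset T κ) : IsDirectedOrder B.1 := B.2.2.2

section

variable [Fact κ.IsRegular] [IsDirectedOrder T] [Nonempty T] (hκ : Cardinal.aleph0 < κ)

include hκ

theorem exists_superset_closed (φ : T → T → Set T) (hφ : ∀ t t', HasCardinalLT (φ t t') κ)
    {S : Set T} (hS : HasCardinalLT S κ) :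
    ∃ B : DirectedSubset T κ, S ⊆ B.1 ∧ ∀ t ∈ B.1, ∀ t' ∈ B.1, φ t t' ⊆ B.1 := by
  obtain ⟨t₀⟩ := ‹Nonempty T›
  choose m hm hm' using exists_ge_ge (α := T)
  obtain ⟨B, hSB, hB, hφB⟩ := exists_hasCardinalLT_superset_closed hκ
    (fun t t' => φ t t' ∪ {m t t'})
    (fun t t' => hasCardinalLT_union hκ.le (hφ t t') (hasCardinalLT_of_finite _ _ hκ.le))
    (hasCardinalLT_union hκ.le hS (hasCardinalLT_of_finite ({t₀} : Set T) _ hκ.le))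
  exact ⟨⟨B, hB, ⟨⟨t₀, hSB (Or.inr rfl)⟩⟩, ⟨fun t t' => ⟨⟨m t t', hφB _ t.2 _ t'.2 (Or.inr rfl)⟩,
    hm _ _, hm' _ _⟩⟩⟩, Set.subset_union_left.trans hSB,
    fun t ht t' ht' => Set.subset_union_left.trans (hφB t ht t' ht')⟩

theorem exists_superset {S : Set T} (hS : HasCardinalLT S κ) :
    ∃ B : DirectedSubset T κ, S ⊆ B.1 := by
  obtain ⟨B, hB, -⟩ := exists_superset_closed hκ (fun _ _ : T => ∅)
    (fun _ _ => hasCardinalLT_of_finite _ _ hκ.le) hS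
  exact ⟨B, hB⟩

theorem isCardinalFiltered : IsCardinalFiltered (DirectedSubset T κ) κ :=
  isCardinalFiltered_preorder _ _ fun K s hK => by
    obtain ⟨B, hB⟩ := exists_superset hκ (hasCardinalLT_iUnion (fun k => (s k).1)
      ((hasCardinalLT_iff_cardinal_mk_lt _ _).2 hK) fun k => (s k).2.1)
    exact ⟨B, fun k => (Set.subset_iUnion _ k).trans hB⟩

end

/-- The inclusion of a directed subset, as a functor. -/
abbrev incl (B : DirectedSubset T κ) : B.1 ⥤ T :=
  Monotone.functor (f := Subtype.val) fun _ _ h => h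

end DirectedSubset

end DirectedSubsets

section PartialColimits

open DirectedSubset

variable {T : Type v} [PartialOrder T] {κ : Cardinal.{v}} {C : Type u} [Category.{v} C]
  [HasFilteredColimitsOfSize.{v, v} C] (D : T ⥤ C)

/-- The colimit of the restriction of a diagram to a directed subset. -/
noncomputable def partialColimit (B : DirectedSubset T κ) : C :=
  colimit (B.incl ⋙ D)

/-- The coprojection to a partial colimit of a term of the diagram. -/
noncomputable def partialInclusion (B : DirectedSubset T κ) {t : T} (ht : t ∈ B.1) :
    D.obj t ⟶ partialColimit D B :=
  colimit.ι (B.incl ⋙ D) ⟨t, ht⟩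

theorem map_comp_partialInclusion (B : DirectedSubset T κ) {t t' : T} (ht : t ∈ B.1)
    (ht' : t' ∈ B.1) (f : t ⟶ t') :
    D.map f ≫ partialInclusion D B ht' = partialInclusion D B ht :=
  colimit.w (B.incl ⋙ D) (j := ⟨t', ht'⟩) (j' := ⟨t, ht⟩) (homOfLE (leOfHom f))

section

variable {C₂ : Type*} [Category* C₂] (F : C ⥤ C₂) (B : DirectedSubset T κ)
  [PreservesColimitsOfShape B.1 F]

variable {D F B} in
theorem map_partialColimit_hom_ext {Y : C₂} {f g : F.obj (partialColimit D B) ⟶ Y}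
    (h : ∀ (t : T) (ht : t ∈ B.1),
      F.map (partialInclusion D B ht) ≫ f = F.map (partialInclusion D B ht) ≫ g) : f = g :=
  (isColimitOfPreserves F (colimit.isColimit (B.incl ⋙ D))).hom_ext fun t => h t.1 t.2

variable {Y : C₂} (φ : ∀ t ∈ B.1, F.obj (D.obj t) ⟶ Y)
  (hφ : ∀ (t t' : T) (ht : t ∈ B.1) (ht' : t' ∈ B.1) (f : t ⟶ t'),
    F.map (D.map f) ≫ φ t' ht' = φ t ht)

/-- The morphism from the image of a partial colimit under a functor which preserves it which is
determined by a compatible family of morphisms. -/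
noncomputable def mapPartialDesc : F.obj (partialColimit D B) ⟶ Y :=
  (isColimitOfPreserves F (colimit.isColimit (B.incl ⋙ D))).desc (Cocone.mk Y
    { app t := φ t.1 t.2
      naturality t t' f :=
        (hφ t.1 t'.1 t.2 t'.2 (homOfLE (leOfHom f))).trans (Category.comp_id _).symm })

theorem map_partialInclusion_comp_mapPartialDesc {t : T} (ht : t ∈ B.1) :
    F.map (partialInclusion D B ht) ≫ mapPartialDesc D F B φ hφ = φ t ht :=
  (isColimitOfPreserves F (colimit.isColimit (B.incl ⋙ D))).fac _ ⟨t, ht⟩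

end

variable {D} in
theorem partialColimit_hom_ext {B : DirectedSubset T κ} {Y : C} {f g : partialColimit D B ⟶ Y}
    (h : ∀ (t : T) (ht : t ∈ B.1),
      partialInclusion D B ht ≫ f = partialInclusion D B ht ≫ g) : f = g :=
  colimit.hom_ext fun t => h t.1 t.2

/-- The morphism from a partial colimit determined by a compatible family of morphisms. -/
noncomputable def partialDesc (B : DirectedSubset T κ) {Y : C} (φ : ∀ t ∈ B.1, D.obj t ⟶ Y)
    (hφ : ∀ (t t' : T) (ht : t ∈ B.1) (ht' : t' ∈ B.1) (f : t ⟶ t'),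
      D.map f ≫ φ t' ht' = φ t ht) : partialColimit D B ⟶ Y :=
  mapPartialDesc D (𝟭 C) B φ hφ

@[simp]
theorem partialInclusion_comp_partialDesc (B : DirectedSubset T κ) {Y : C}
    (φ : ∀ t ∈ B.1, D.obj t ⟶ Y) (hφ) {t : T} (ht : t ∈ B.1) :
    partialInclusion D B ht ≫ partialDesc D B φ hφ = φ t ht :=
  map_partialInclusion_comp_mapPartialDesc D (𝟭 C) B φ hφ ht

/-- The diagram of all partial colimits over `κ`-small directed subsets. -/
noncomputable abbrev partialColimits (κ : Cardinal.{v}) : DirectedSubset T κ ⥤ C where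
  obj B := partialColimit D B
  map {B B'} f := partialDesc D B (fun _ ht => partialInclusion D B' (leOfHom f ht))
    fun _ _ _ _ g => map_comp_partialInclusion D B' _ _ g
  map_id B := partialColimit_hom_ext fun t ht => by simp
  map_comp {B B' B''} f g := partialColimit_hom_ext fun t ht => by
    rw [partialInclusion_comp_partialDesc, ← Category.assoc, partialInclusion_comp_partialDesc,
      partialInclusion_comp_partialDesc]

theorem partialInclusion_comp_app {B B' : DirectedSubset T κ} (f : B ⟶ B') {t : T}
    (ht : t ∈ B.1) (s : Cocone (partialColimits D κ)) :
    partialInclusion D B' (leOfHom f ht) ≫ s.ι.app B' = partialInclusion D B ht ≫ s.ι.app B := by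
  rw [← s.w f, ← Category.assoc, partialInclusion_comp_partialDesc]

variable {D} (c : Cocone D)

/-- The comparison from a partial colimit to the point of a cocone on the whole diagram. -/
noncomputable def coconeDesc (B : DirectedSubset T κ) : partialColimit D B ⟶ c.pt :=
  partialDesc D B (fun t _ => c.ι.app t) fun _ _ _ _ f => c.w f

@[simp]
theorem partialInclusion_comp_coconeDesc (B : DirectedSubset T κ) {t : T} (ht : t ∈ B.1) :
    partialInclusion D B ht ≫ coconeDesc c B = c.ι.app t :=
  partialInclusion_comp_partialDesc D B _ _ ht

/-- The cocone on the diagram of partial colimits induced by a cocone on the whole diagram. -/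
noncomputable abbrev partialColimitsCocone (κ : Cardinal.{v}) : Cocone (partialColimits D κ) :=
  Cocone.mk c.pt
    { app B := coconeDesc c B
      naturality B B' f := partialColimit_hom_ext fun t ht => by
        dsimp only [partialColimits, Functor.const_obj_obj, Functor.const_obj_map]
        rw [← Category.assoc, partialInclusion_comp_partialDesc, Category.comp_id,
          partialInclusion_comp_coconeDesc, partialInclusion_comp_coconeDesc] }

section

variable [Fact κ.IsRegular] [IsDirectedOrder T] [Nonempty T] (hκ : Cardinal.aleph0 < κ)

include hκ

theorem partialInclusion_comp_app_eq (s : Cocone (partialColimits D κ)) {B B' : DirectedSubset T κ}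
    {t : T} (ht : t ∈ B.1) (ht' : t ∈ B'.1) :
    partialInclusion D B ht ≫ s.ι.app B = partialInclusion D B' ht' ≫ s.ι.app B' := by
  have := isCardinalFiltered (T := T) hκ
  have := isFiltered_of_isCardinalFiltered (DirectedSubset T κ) κ
  rw [← partialInclusion_comp_app D (IsFiltered.leftToMax B B') ht,
    ← partialInclusion_comp_app D (IsFiltered.rightToMax B B') ht']

theorem nonempty_isColimit_partialColimitsCocone (hc : IsColimit c) :
    Nonempty (IsColimit (partialColimitsCocone c κ)) := by
  have hfin (S : Set T) (hS : S.Finite) : ∃ B : DirectedSubset T κ, S ⊆ B.1 :=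
    have := hS.to_subtype
    exists_superset hκ (hasCardinalLT_of_finite _ _ hκ.le)
  choose B hB using fun t : T => hfin {t} (Set.finite_singleton t)
  have hB (t : T) : t ∈ (B t).1 := hB t rfl
  let d (s : Cocone (partialColimits D κ)) : Cocone D := Cocone.mk s.pt
    { app t := partialInclusion D (B t) (hB t) ≫ s.ι.app (B t)
      naturality t t' f := by
        obtain ⟨B', hB'⟩ := hfin {t, t'} (Set.toFinite _)
        have ht : t ∈ B'.1 := hB' (Or.inl rfl)
        have ht' : t' ∈ B'.1 := hB' (Or.inr rfl)
        rw [partialInclusion_comp_app_eq hκ s (hB t) ht,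
          partialInclusion_comp_app_eq hκ s (hB t') ht', ← Category.assoc,
          map_comp_partialInclusion D B' ht ht' f]
        exact (Category.comp_id _).symm }
  refine ⟨{ desc s := hc.desc (d s), fac s B' := ?_, uniq s m hm := hc.hom_ext fun t => ?_ }⟩
  · refine partialColimit_hom_ext fun t ht => ?_
    rw [← Category.assoc, partialInclusion_comp_coconeDesc, hc.fac]
    exact partialInclusion_comp_app_eq hκ s (hB t) ht
  · rw [hc.fac, ← partialInclusion_comp_coconeDesc c (B t) (hB t), Category.assoc, hm (B t)]

end

theorem isCardinalPresentable_map_partialColimit [Fact κ.IsRegular] {C₂ : Type u'}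
    [Category.{v} C₂] (F : C ⥤ C₂) (B : DirectedSubset T κ) [PreservesColimitsOfShape B.1 F]
    (hD : ∀ t, IsCardinalPresentable (F.obj (D.obj t)) κ) :
    IsCardinalPresentable (F.obj (partialColimit D B)) κ :=
  have (t : B.1) : IsCardinalPresentable (((B.incl ⋙ D) ⋙ F).obj t) κ := hD t.1
  isCardinalPresentable_of_isColimit _
    (isColimitOfPreserves F (colimit.isColimit (B.incl ⋙ D))) κ
    (hasCardinalLT_arrow_of_preorder B.2.1)

end PartialColimits

section RaisingIndex

attribute [local instance] Cardinal.fact_isRegular_aleph0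

variable {C : Type u} [Category.{v} C]

theorem preservesColimitsOfShape_directedSubset {T : Type v} [PartialOrder T] {κ : Cardinal.{v}}
    {C₂ : Type u'} [Category.{v} C₂] (F : C ⥤ C₂) [Functor.IsFinitelyAccessible.{v} F]
    (B : DirectedSubset T κ) : PreservesColimitsOfShape B.1 F :=
  have : IsCardinalFiltered B.1 Cardinal.aleph0.{v} :=
    (isCardinalFiltered_aleph0_iff B.1).2 inferInstance
  F.preservesColimitsOfShape_of_isCardinalAccessible Cardinal.aleph0.{v} B.1

theorem exists_poset_colimitPresentation (κ : Cardinal.{v}) [Fact κ.IsRegular]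
    [IsCardinalAccessibleCategory C κ] (X : C) :
    ∃ (T : Type v) (_ : PartialOrder T) (_ : IsCardinalFiltered T κ),
      Nonempty ((isCardinalPresentable C κ).ColimitOfShape T X) := by
  obtain ⟨J, _, _, ⟨p⟩⟩ :=
    (isCardinalFilteredGenerator_isCardinalPresentable C κ).exists_colimitsOfShape X
  obtain ⟨T, _, _, G, _⟩ := IsCardinalFiltered.exists_cardinal_directed J κ
  exact ⟨T, inferInstance, inferInstance, ⟨p.reindex G⟩⟩

theorem isCardinalPresentable_obj_of_isFinitelyAccessible {κ l : Cardinal.{v}} [Fact κ.IsRegular]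
    [Fact l.IsRegular] [IsCardinalAccessibleCategory C κ] [HasFilteredColimitsOfSize.{v, v} C]
    (hl : Cardinal.aleph0 < l)
    {C₂ : Type u'} [Category.{v} C₂] (F : C ⥤ C₂) [Functor.IsFinitelyAccessible.{v} F]
    (hF : ∀ X, IsCardinalPresentable X κ → IsCardinalPresentable (F.obj X) l) (X : C)
    [IsCardinalPresentable X l] : IsCardinalPresentable (F.obj X) l := by
  obtain ⟨T, _, _, ⟨p⟩⟩ := exists_poset_colimitPresentation κ X
  have := isFiltered_of_isCardinalFiltered T κ
  have := IsFiltered.isDirectedOrder T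
  have : Nonempty T := IsFiltered.nonempty
  obtain ⟨hc⟩ := nonempty_isColimit_partialColimitsCocone _ hl p.isColimit
  have := DirectedSubset.isCardinalFiltered (T := T) hl
  obtain ⟨B, i, hi⟩ := IsCardinalPresentable.exists_hom_of_isColimit l hc (𝟙 X)
  have := preservesColimitsOfShape_directedSubset F B
  have := isCardinalPresentable_map_partialColimit F B fun t => hF _ (p.prop_diag_obj t)
  exact Retract.isCardinalPresentable (Retract.map ⟨i, coconeDesc p.cocone B, hi⟩ F) l

end RaisingIndex

section Tensor

attribute [local instance] Cardinal.fact_isRegular_aleph0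

variable {A : Type u} [Category.{v} A] [MonoidalCategory A]

theorem isCardinalPresentable_tensor {κ l : Cardinal.{v}} [Fact κ.IsRegular] [Fact l.IsRegular]
    [IsCardinalLocallyPresentable A κ] (hl : Cardinal.aleph0 < l)
    [∀ X : A, Functor.IsFinitelyAccessible.{v} (tensorLeft X)]
    [∀ X : A, Functor.IsFinitelyAccessible.{v} (tensorRight X)]
    (h : ∀ X Y : A, IsCardinalPresentable X κ → IsCardinalPresentable Y κ →
      IsCardinalPresentable (X ⊗ Y) l) (X Y : A)
    [IsCardinalPresentable X l] [IsCardinalPresentable Y l] :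
    IsCardinalPresentable (X ⊗ Y) l :=
  isCardinalPresentable_obj_of_isFinitelyAccessible (κ := κ) hl (tensorRight Y) (fun X hX =>
    isCardinalPresentable_obj_of_isFinitelyAccessible (κ := κ) hl (tensorLeft X) (h X · hX) Y) X

theorem exists_cardinal_isCardinalPresentable_tensor [IsLocallyPresentable.{v} A]
    [∀ X : A, Functor.IsFinitelyAccessible.{v} (tensorLeft X)]
    [∀ X : A, Functor.IsFinitelyAccessible.{v} (tensorRight X)] :
    ∃ κ₀ : Cardinal.{v}, ∀ (l : Cardinal.{v}) [Fact l.IsRegular], κ₀ ≤ l → Cardinal.aleph0 < l →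
      ∀ X Y : A, IsCardinalPresentable X l → IsCardinalPresentable Y l →
        IsCardinalPresentable (X ⊗ Y) l := by
  obtain ⟨κ, _, _⟩ := IsLocallyPresentable.exists_cardinal.{v} A
  obtain ⟨Q, _, -, hQ⟩ :=
    ObjectProperty.EssentiallySmall.exists_small_le.{v} (isCardinalPresentable A κ)
  obtain ⟨κ₀, hκ₀⟩ := exists_cardinal_forall_isCardinalPresentable.{v}
    fun p : Subtype Q × Subtype Q => p.1.1 ⊗ p.2.1
  refine ⟨κ₀, fun l _ hl hl' X Y _ _ => isCardinalPresentable_tensor (κ := κ) hl' ?_ X Y⟩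
  intro X Y hX hY
  obtain ⟨X', hX', ⟨e⟩⟩ := hQ X hX
  obtain ⟨Y', hY', ⟨e'⟩⟩ := hQ Y hY
  have := hκ₀ l hl (⟨X', hX'⟩, ⟨Y', hY'⟩)
  exact isCardinalPresentable_of_iso (e ⊗ᵢ e').symm l

end Tensor

section SimultaneousFactorization

variable {C : Type u} [Category.{v} C] {C₂ : Type u'} [Category.{v} C₂] {κ : Cardinal.{v}}
  [Fact κ.IsRegular] {J : Type v} [SmallCategory J] [IsCardinalFiltered J κ] {D : J ⥤ C}
  {c : Cocone D} (hc : IsColimit c) {K : Type w} (hK : HasCardinalLT K κ) (H : K → C ⥤ C₂)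
  [∀ k, (H k).IsCardinalAccessible κ] {P : K → C₂} [∀ k, IsCardinalPresentable (P k) κ]

include hc hK

theorem exists_forall_comp_map_eq (f : ∀ k, P k ⟶ (H k).obj c.pt) :
    ∃ (j : J) (g : ∀ k, P k ⟶ (H k).obj (D.obj j)), ∀ k, g k ≫ (H k).map (c.ι.app j) = f k := by
  have (k : K) := (H k).preservesColimitsOfShape_of_isCardinalAccessible κ J
  choose j g hg using fun k =>
    IsCardinalPresentable.exists_hom_of_isColimit κ (isColimitOfPreserves (H k) hc) (f k)
  refine ⟨IsCardinalFiltered.max j hK,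
    fun k => g k ≫ (H k).map (D.map (IsCardinalFiltered.toMax j hK k)), fun k => ?_⟩
  rw [Category.assoc, ← Functor.map_comp, c.w]
  exact hg k

theorem exists_forall_comp_map_eq_comp_map {j : J} (f g : ∀ k, P k ⟶ (H k).obj (D.obj j))
    (h : ∀ k, f k ≫ (H k).map (c.ι.app j) = g k ≫ (H k).map (c.ι.app j)) :
    ∃ (j' : J) (u : j ⟶ j'), ∀ k, f k ≫ (H k).map (D.map u) = g k ≫ (H k).map (D.map u) := by
  have (k : K) := (H k).preservesColimitsOfShape_of_isCardinalAccessible κ J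
  choose j' u hu using fun k =>
    IsCardinalPresentable.exists_eq_of_isColimit' κ (isColimitOfPreserves (H k) hc)
      (f k) (g k) (h k)
  obtain ⟨l, a, u', ha⟩ := IsCardinalFiltered.wideSpan u hK
  refine ⟨l, u', fun k => ?_⟩
  have hu : f k ≫ (H k).map (D.map (u k)) = g k ≫ (H k).map (D.map (u k)) := hu k
  rw [← ha k, D.map_comp, Functor.map_comp, reassoc_of% hu]

end SimultaneousFactorization

section Dialgebras

variable {C : Type u} [Category.{v} C] {C₂ : Type u'} [Category.{v} C₂] {I : Type w}

/-- A dialgebra for two families of functors `F` and `G` is an object `X` equipped with morphisms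
`(F i).obj X ⟶ (G i).obj X`. Dialgebras form the inserter of the families `F` and `G`. -/
structure Dialgebra (F G : I → C ⥤ C₂) where
  /-- The underlying object. -/
  X : C
  /-- The structure morphisms. -/
  str (i : I) : (F i).obj X ⟶ (G i).obj X

namespace Dialgebra

variable {F G : I → C ⥤ C₂}

/-- Morphisms of dialgebras commute with the structure morphisms. -/
@[ext]
structure Hom (X Y : Dialgebra F G) where
  /-- The underlying morphism. -/
  hom : X.X ⟶ Y.X
  comm (i : I) : X.str i ≫ (G i).map hom = (F i).map hom ≫ Y.str i

instance : Category (Dialgebra F G) where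
  Hom := Hom
  id X := ⟨𝟙 X.X, fun i => by simp⟩
  comp f g := ⟨f.hom ≫ g.hom, fun i => by
    rw [Functor.map_comp, ← Category.assoc, f.comm, Category.assoc, g.comm, Functor.map_comp,
      Category.assoc]⟩

@[ext]
theorem hom_ext {X Y : Dialgebra F G} {f g : X ⟶ Y} (h : f.hom = g.hom) : f = g := Hom.ext h

@[simp]
theorem id_hom (X : Dialgebra F G) : Hom.hom (𝟙 X) = 𝟙 X.X := rfl

@[simp]
theorem comp_hom {X Y Z : Dialgebra F G} (f : X ⟶ Y) (g : Y ⟶ Z) :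
    (f ≫ g).hom = f.hom ≫ g.hom := rfl

variable (F G) in
/-- The underlying object of a dialgebra. -/
def forget : Dialgebra F G ⥤ C where
  obj X := X.X
  map f := f.hom

instance : (forget F G).Faithful where
  map_injective h := hom_ext h

/-- An isomorphism of dialgebras from an isomorphism of the underlying objects. -/
def isoMk {X Y : Dialgebra F G} (e : X.X ≅ Y.X)
    (h : ∀ i, X.str i ≫ (G i).map e.hom = (F i).map e.hom ≫ Y.str i) : X ≅ Y where
  hom := ⟨e.hom, h⟩
  inv := ⟨e.inv, fun i => by
    rw [← cancel_epi ((F i).map e.hom), ← Category.assoc, ← h i]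
    simp [← Functor.map_comp, ← Functor.map_comp_assoc]⟩

instance : (forget F G).ReflectsIsomorphisms where
  reflects {X Y} f _ := by
    have : IsIso f.hom := inferInstanceAs (IsIso ((forget F G).map f))
    exact (isoMk (asIso f.hom) f.comm).isIso_hom

variable (F G) in
/-- The structure morphisms, as a natural transformation. -/
def strNatTrans (i : I) : forget F G ⋙ F i ⟶ forget F G ⋙ G i where
  app X := X.str i
  naturality _ _ f := (f.comm i).symm

theorem map_comp_str {X Z : Dialgebra F G} {i : I} {Y : C} {x : X.X ⟶ Y} {y : Y ⟶ Z.X}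
    {s : (F i).obj Y ⟶ (G i).obj Y} (hs : (F i).map x ≫ s = X.str i ≫ (G i).map x) (f : X ⟶ Z)
    (hf : x ≫ y = f.hom) :
    (F i).map x ≫ s ≫ (G i).map y = (F i).map x ≫ (F i).map y ≫ Z.str i := by
  rw [reassoc_of% hs, ← Functor.map_comp, ← Functor.map_comp_assoc, hf, f.comm]

theorem str_comp_map_comp_map {X Y Z : Dialgebra F G} (i : I) {x : X.X ⟶ Y.X} (y : Y ⟶ Z)
    (f : X ⟶ Z) (hf : x ≫ y.hom = f.hom) :
    (X.str i ≫ (G i).map x) ≫ (G i).map y.hom = ((F i).map x ≫ Y.str i) ≫ (G i).map y.hom := by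
  rw [Category.assoc, ← Functor.map_comp, hf, f.comm, ← hf, Category.assoc, y.comm,
    Functor.map_comp, Category.assoc]

theorem str_comp_map_of_equalizes {X Y Z : Dialgebra F G} (i : I) {x : X.X ⟶ Y.X} (y : Y ⟶ Z)
    (h : (X.str i ≫ (G i).map x) ≫ (G i).map y.hom =
      ((F i).map x ≫ Y.str i) ≫ (G i).map y.hom) :
    X.str i ≫ (G i).map (x ≫ y.hom) = (F i).map (x ≫ y.hom) ≫ Z.str i := by
  rw [Functor.map_comp, ← Category.assoc, h, Category.assoc, y.comm, Functor.map_comp,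
    Category.assoc]

section Colimits

variable {J : Type*} [Category* J] (D : J ⥤ Dialgebra F G) (c : Cocone (D ⋙ forget F G))
  (hc : IsColimit c) [∀ i, PreservesColimit (D ⋙ forget F G) (F i)]

/-- The structure morphisms on a colimit of underlying objects. -/
noncomputable def colimitStr (i : I) : (F i).obj c.pt ⟶ (G i).obj c.pt :=
  (isColimitOfPreserves (F i) hc).desc (Cocone.mk ((G i).obj c.pt)
    (Functor.whiskerLeft D (strNatTrans F G i) ≫ Cocone.ι ((G i).mapCocone c)))

theorem map_app_colimitStr (i : I) (j : J) :
    (F i).map (c.ι.app j) ≫ colimitStr D c hc i = (D.obj j).str i ≫ (G i).map (c.ι.app j) :=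
  (isColimitOfPreserves (F i) hc).fac _ j

/-- The cocone of dialgebras on a colimit cocone of underlying objects. -/
noncomputable def colimitCocone : Cocone D :=
  Cocone.mk ⟨c.pt, colimitStr D c hc⟩
    { app j := ⟨c.ι.app j, fun i => (map_app_colimitStr D c hc i j).symm⟩
      naturality _ _ f := hom_ext (c.ι.naturality f) }

/-- A colimit of underlying objects is a colimit of dialgebras. -/
noncomputable def isColimitColimitCocone : IsColimit (colimitCocone D c hc) where
  desc s := ⟨hc.desc ((forget F G).mapCocone s), fun i =>
    (isColimitOfPreserves (F i) hc).hom_ext fun j =>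
      map_comp_str (map_app_colimitStr D c hc i j) (s.ι.app j)
        (hc.fac ((forget F G).mapCocone s) j)⟩
  fac s j := hom_ext (hc.fac ((forget F G).mapCocone s) j)
  uniq s m hm := hom_ext (hc.uniq ((forget F G).mapCocone s) m.hom
    fun j => congrArg Hom.hom (hm j))

noncomputable instance : CreatesColimit D (forget F G) :=
  createsColimitOfReflectsIso fun c hc =>
    { liftedCocone := colimitCocone D c hc
      validLift := Cocone.ext (Iso.refl _) fun _ => Category.comp_id _
      makesColimit := isColimitColimitCocone D c hc }

end Colimits

variable {κ : Cardinal.{v}}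

section Presentable

variable [Fact κ.IsRegular] [HasFilteredColimitsOfSize.{v, v} C] (hI : HasCardinalLT I κ)
  [∀ i, (F i).IsCardinalAccessible κ] [∀ i, (G i).IsCardinalAccessible κ]

include hI in
theorem isCardinalPresentable_of_X (X : Dialgebra F G) [IsCardinalPresentable X.X κ]
    [∀ i, IsCardinalPresentable ((F i).obj X.X) κ] : IsCardinalPresentable X κ where
  preservesColimitOfShape J _ _ := ⟨fun {D} => ⟨fun {c} hc => ⟨by
    have := isFiltered_of_isCardinalFiltered J κ
    have (i : I) := (F i).preservesColimitsOfShape_of_isCardinalAccessible κ J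
    have hc' := isColimitOfPreserves (forget F G) hc
    refine Types.FilteredColimit.isColimitOf' _ _ (fun (f : X ⟶ c.pt) => ?_)
      (fun j (f g : X ⟶ D.obj j) hfg => ?_)
    · obtain ⟨j, f', hf'⟩ : ∃ (j : J) (f' : X.X ⟶ (D.obj j).X), f' ≫ (c.ι.app j).hom = f.hom :=
        IsCardinalPresentable.exists_hom_of_isColimit κ hc' f.hom
      obtain ⟨k, a, ha⟩ := exists_forall_comp_map_eq_comp_map hc' hI G (j := j)
        (fun i => X.str i ≫ (G i).map f') (fun i => (F i).map f' ≫ (D.obj j).str i)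
        fun i => str_comp_map_comp_map i (c.ι.app j) f hf'
      refine ⟨k, ⟨f' ≫ (D.map a).hom, fun i => str_comp_map_of_equalizes i (D.map a) (ha i)⟩,
        hom_ext ?_⟩
      · refine hf'.symm.trans ?_
        rw [← c.w a]
        exact (Category.assoc _ _ _).symm
    · obtain ⟨k, a, h⟩ := IsCardinalPresentable.exists_eq_of_isColimit' κ hc' f.hom g.hom
        (congrArg Hom.hom hfg)
      exact ⟨k, a, hom_ext h⟩⟩⟩⟩

end Presentable

theorem essentiallySmall_inverseImage_forget [Small.{v} I] (P : ObjectProperty C)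
    [ObjectProperty.EssentiallySmall.{v} P] :
    ObjectProperty.EssentiallySmall.{v} (P.inverseImage (forget F G)) := by
  obtain ⟨Q, _, hQ⟩ := ObjectProperty.EssentiallySmall.exists_small_le' P
  let Y (a : Σ P : Subtype Q, ∀ i, (F i).obj P.1 ⟶ (G i).obj P.1) : Dialgebra F G := ⟨a.1.1, a.2⟩
  refine ⟨.ofObj Y, inferInstance, fun X hX => ?_⟩
  obtain ⟨Z, hZ, ⟨e⟩⟩ := hQ _ hX
  let a : Σ P : Subtype Q, ∀ i, (F i).obj P.1 ⟶ (G i).obj P.1 :=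
    ⟨⟨Z, hZ⟩, fun i => (F i).map e.inv ≫ X.str i ≫ (G i).map e.hom⟩
  exact ⟨Y a, ⟨a⟩,
    ⟨isoMk (X := X) (Y := Y a) e fun i => (Iso.map_hom_inv_id_assoc e (F i) _).symm⟩⟩

section Enlargement

/-- The structure morphisms of a dialgebra `X`, presented as the colimit of a diagram on a poset,
lifted to the terms of the diagram: the restriction of `X.str i` to the term `t` takes values in
the term `next t`, and the restrictions to the terms `t ≤ t'` are compatible in the term
`bound t t'`. -/
structure LiftedStr (X : Dialgebra F G) {T : Type v} [PartialOrder T]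
    (p : ColimitPresentation T X.X) where
  /-- The index of the target of the structure morphisms on a term. -/
  next : T → T
  /-- The structure morphisms on a term. -/
  str (t : T) (i : I) : (F i).obj (p.diag.obj t) ⟶ (G i).obj (p.diag.obj (next t))
  str_comp_map (t : T) (i : I) :
    str t i ≫ (G i).map (p.ι.app (next t)) = (F i).map (p.ι.app t) ≫ X.str i
  /-- The index where the structure morphisms on two terms agree. -/
  bound : T → T → T
  next_le_bound (t t' : T) : next t ≤ bound t t'
  next_le_bound' (t t' : T) : next t' ≤ bound t t'
  map_comp_str {t t' : T} (f : t ⟶ t') (i : I) :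
    (F i).map (p.diag.map f) ≫ str t' i ≫ (G i).map (p.diag.map (homOfLE (next_le_bound' t t'))) =
      str t i ≫ (G i).map (p.diag.map (homOfLE (next_le_bound t t')))

variable {X : Dialgebra F G} {T : Type v} [PartialOrder T]

theorem nonempty_liftedStr [Fact κ.IsRegular] (hI : HasCardinalLT I κ) [IsCardinalFiltered T κ]
    [∀ i, (G i).IsCardinalAccessible κ] (p : ColimitPresentation T X.X)
    (hp : ∀ t i, IsCardinalPresentable ((F i).obj (p.diag.obj t)) κ) :
    Nonempty (LiftedStr X p) := by
  have := isFiltered_of_isCardinalFiltered T κ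
  have := IsFiltered.isDirectedOrder T
  choose next str hstr using fun t => exists_forall_comp_map_eq p.isColimit hI G
    fun i => (F i).map (p.ι.app t) ≫ X.str i
  have hbound (t t' : T) : ∃ (b : T) (h : next t ≤ b) (h' : next t' ≤ b), ∀ (f : t ⟶ t') i,
      (F i).map (p.diag.map f) ≫ str t' i ≫ (G i).map (p.diag.map (homOfLE h')) =
        str t i ≫ (G i).map (p.diag.map (homOfLE h)) := by
    obtain ⟨m, h, h'⟩ := exists_ge_ge (next t) (next t')
    by_cases hf : Nonempty (t ⟶ t')
    · obtain ⟨f⟩ := hf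
      obtain ⟨b, u, hb⟩ := exists_forall_comp_map_eq_comp_map p.isColimit hI G (j := m)
        (fun i => (F i).map (p.diag.map f) ≫ str t' i ≫ (G i).map (p.diag.map (homOfLE h')))
        (fun i => str t i ≫ (G i).map (p.diag.map (homOfLE h))) fun i => by
          have h₁ := hstr t' i
          have h₂ := hstr t i
          dsimp at h₁ h₂ ⊢
          simp only [Category.assoc, ← Functor.map_comp, p.w, h₁, h₂]
          rw [← Functor.map_comp_assoc, p.w]
      refine ⟨b, h.trans (leOfHom u), h'.trans (leOfHom u), fun g i => ?_⟩
      obtain rfl := Subsingleton.elim f g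
      have := hb i
      simp only [Category.assoc, ← Functor.map_comp] at this
      exact this
    · exact ⟨m, h, h', fun f => (hf ⟨f⟩).elim⟩
  choose bound h h' hbound using hbound
  exact ⟨⟨next, str, hstr, bound, h, h', fun f => hbound _ _ f⟩⟩

namespace LiftedStr

variable {p : ColimitPresentation T X.X} (s : LiftedStr X p)

/-- The indices which have to belong to a directed subset containing `t` and `t'` for the
structure morphisms to descend to its partial colimit. -/
abbrev support (t t' : T) : Set T := {s.next t, s.bound t t'}

section Extension

variable [Fact κ.IsRegular] {K : Type v} (hK : HasCardinalLT K κ) {Y : K → Dialgebra F G}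
  (hY : ∀ k i, IsCardinalPresentable ((F i).obj (Y k).X) κ) (f : ∀ k, Y k ⟶ X)

include hK hY in
theorem exists_str_comp_map_eq (hI : HasCardinalLT I κ) [IsCardinalFiltered T κ]
    [∀ i, (G i).IsCardinalAccessible κ] {t : T} (g : ∀ k, (Y k).X ⟶ p.diag.obj t)
    (hg : ∀ k, g k ≫ p.ι.app t = (f k).hom) :
    ∃ (t' : T) (h : t ≤ t') (h' : s.next t ≤ t'), ∀ k i,
      (Y k).str i ≫ (G i).map (g k ≫ p.diag.map (homOfLE h)) =
        (F i).map (g k) ≫ s.str t i ≫ (G i).map (p.diag.map (homOfLE h')) := by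
  have := isFiltered_of_isCardinalFiltered T κ
  have := IsFiltered.isDirectedOrder T
  obtain ⟨j, hj, hj'⟩ := exists_ge_ge t (s.next t)
  have (a : K × I) := hY a.1 a.2
  obtain ⟨t', u, ht'⟩ := exists_forall_comp_map_eq_comp_map p.isColimit
    (hasCardinalLT_prod (Cardinal.IsRegular.aleph0_le Fact.out) hK hI) (fun a : K × I => G a.2)
    (j := j) (fun a => (Y a.1).str a.2 ≫ (G a.2).map (g a.1 ≫ p.diag.map (homOfLE hj)))
    (fun a => (F a.2).map (g a.1) ≫ s.str t a.2 ≫ (G a.2).map (p.diag.map (homOfLE hj')))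
    fun ⟨k, i⟩ => by
      have h := s.str_comp_map t i
      dsimp at h ⊢
      simp only [Category.assoc, ← Functor.map_comp, p.w, h]
      rw [← Functor.map_comp_assoc, hg, (f k).comm]
  refine ⟨t', hj.trans (leOfHom u), hj'.trans (leOfHom u), fun k i => ?_⟩
  have := ht' (k, i)
  simp only [Category.assoc, ← Functor.map_comp] at this
  exact this

end Extension

variable {B : DirectedSubset T κ} (hB : ∀ t ∈ B.1, ∀ t' ∈ B.1, s.support t t' ⊆ B.1)

include hB in
theorem next_mem {t : T} (ht : t ∈ B.1) : s.next t ∈ B.1 := hB t ht t ht (Or.inl rfl)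

variable [HasFilteredColimitsOfSize.{v, v} C] [∀ i, PreservesColimitsOfShape B.1 (F i)]

/-- The structure morphisms on a partial colimit. -/
noncomputable def partialStr (i : I) :
    (F i).obj (partialColimit p.diag B) ⟶ (G i).obj (partialColimit p.diag B) :=
  mapPartialDesc p.diag (F i) B
    (fun t ht => s.str t i ≫ (G i).map (partialInclusion p.diag B (s.next_mem hB ht)))
    fun t t' ht ht' f => by
      have hb : s.bound t t' ∈ B.1 := hB t ht t' ht' (Or.inr rfl)
      rw [← map_comp_partialInclusion p.diag B _ hb (homOfLE (s.next_le_bound' t t')),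
        ← map_comp_partialInclusion p.diag B _ hb (homOfLE (s.next_le_bound t t')),
        Functor.map_comp, Functor.map_comp, reassoc_of% (s.map_comp_str f i)]

theorem map_partialInclusion_comp_partialStr (i : I) {t : T} (ht : t ∈ B.1) :
    (F i).map (partialInclusion p.diag B ht) ≫ s.partialStr hB i =
      s.str t i ≫ (G i).map (partialInclusion p.diag B (s.next_mem hB ht)) :=
  map_partialInclusion_comp_mapPartialDesc ..

/-- The partial colimit over a directed subset, as a dialgebra. -/
noncomputable abbrev partialDialgebra : Dialgebra F G where
  X := partialColimit p.diag B
  str i := s.partialStr hB i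

/-- The comparison from a partial colimit, as a morphism of dialgebras. -/
noncomputable def partialDialgebraHom : s.partialDialgebra hB ⟶ X where
  hom := coconeDesc p.cocone B
  comm i := map_partialColimit_hom_ext fun t ht => by
    rw [← Category.assoc, s.map_partialInclusion_comp_partialStr hB i ht, Category.assoc,
      ← Functor.map_comp, ← Functor.map_comp_assoc, partialInclusion_comp_coconeDesc,
      partialInclusion_comp_coconeDesc]
    exact s.str_comp_map t i

/-- A morphism to a partial colimit, as a morphism of dialgebras. -/
noncomputable def homPartialDialgebra (Y : Dialgebra F G) {t t' : T} (ht : t ∈ B.1)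
    (ht' : t' ∈ B.1) (h : t ≤ t') (h' : s.next t ≤ t') (g : Y.X ⟶ p.diag.obj t)
    (hg : ∀ i, Y.str i ≫ (G i).map (g ≫ p.diag.map (homOfLE h)) =
      (F i).map g ≫ s.str t i ≫ (G i).map (p.diag.map (homOfLE h'))) :
    Y ⟶ s.partialDialgebra hB where
  hom := g ≫ partialInclusion p.diag B ht
  comm i := by
    rw [Functor.map_comp (F i), Category.assoc, s.map_partialInclusion_comp_partialStr hB i ht,
      ← map_comp_partialInclusion p.diag B ht ht' (homOfLE h),
      ← map_comp_partialInclusion p.diag B (s.next_mem hB ht) ht' (homOfLE h'),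
      ← Category.assoc g, Functor.map_comp (G i), reassoc_of% (hg i), Functor.map_comp (G i)]

end LiftedStr

theorem hasPresentableEnlargements_forget [Fact κ.IsRegular] [IsCardinalAccessibleCategory C κ]
    [HasFilteredColimitsOfSize.{v, v} C] (hκ : Cardinal.aleph0 < κ) (hI : HasCardinalLT I κ)
    [∀ i, Functor.IsFinitelyAccessible.{v} (F i)] [∀ i, (G i).IsCardinalAccessible κ]
    (hF : ∀ i X, IsCardinalPresentable X κ → IsCardinalPresentable ((F i).obj X) κ) :
    HasPresentableEnlargements (forget F G) κ := by
  intro X K hK Y hY f P hP x g hg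
  obtain ⟨T, _, _, ⟨p⟩⟩ := exists_poset_colimitPresentation κ X.X
  have := isFiltered_of_isCardinalFiltered T κ
  have := IsFiltered.isDirectedOrder T
  have : Nonempty T := IsFiltered.nonempty
  obtain ⟨s⟩ := nonempty_liftedStr hI p.toColimitPresentation
    fun t i => hF i _ (p.prop_diag_obj t)
  obtain ⟨t, x, rfl⟩ := IsCardinalPresentable.exists_hom_of_isColimit κ p.isColimit x
  obtain ⟨t', h, h', ht'⟩ := s.exists_str_comp_map_eq hK (fun k i => hF i _ (hY k)) f hI
    (fun k => g k ≫ x) fun k => (Category.assoc _ _ _).trans (hg k)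
  obtain ⟨B, hS, hB⟩ := DirectedSubset.exists_superset_closed hκ s.support
    (fun _ _ => hasCardinalLT_of_finite _ _ hκ.le)
    (S := {t, t'}) (hasCardinalLT_of_finite _ _ hκ.le)
  have (i : I) := preservesColimitsOfShape_directedSubset (F i) B
  exact ⟨s.partialDialgebra hB,
    isCardinalPresentable_map_partialColimit (𝟭 C) B p.prop_diag_obj,
    s.partialDialgebraHom hB, x ≫ partialInclusion p.diag B (hS (Or.inl rfl)),
    fun k => s.homPartialDialgebra hB (Y k) _ (hS (Or.inr rfl)) h h' (g k ≫ x) (ht' k),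
    (Category.assoc _ _ _).trans
      (congrArg (x ≫ ·) (partialInclusion_comp_coconeDesc p.cocone B _)),
    fun k => (Category.assoc _ _ _).symm⟩

end Enlargement

end Dialgebra

end Dialgebras

section Equations

attribute [local instance] Cardinal.fact_isRegular_aleph0

variable {E : Type u} [Category.{v} E] {E' : Type u'} [Category.{v} E']

theorem isCardinalPresentable_of_fullyFaithful (V : E' ⥤ E) [V.Full] [V.Faithful]
    (κ : Cardinal.{v}) [Fact κ.IsRegular] [V.IsCardinalAccessible κ] (X : E')
    [IsCardinalPresentable (V.obj X) κ] : IsCardinalPresentable X κ :=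
  Functor.isCardinalAccessible_of_natIso
    (show V ⋙ coyoneda.obj (op (V.obj X)) ≅ coyoneda.obj (op X) from
      NatIso.ofComponents (fun Y => (Functor.FullyFaithful.ofFullyFaithful V).homEquiv.symm.toIso)
        fun f => by
          ext g
          exact V.map_injective (by simp [Functor.FullyFaithful.homEquiv])) κ

theorem essentiallySmall_inverseImage_of_fullyFaithful (V : E' ⥤ E) [V.Full] [V.Faithful]
    (P : ObjectProperty E) [ObjectProperty.EssentiallySmall.{v} P] :
    ObjectProperty.EssentiallySmall.{v} (P.inverseImage V) := by
  obtain ⟨Q, _, hQ, hQ'⟩ :=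
    (ObjectProperty.EssentiallySmall.of_le inf_le_left :
      ObjectProperty.EssentiallySmall.{v} (P ⊓ V.essImage)).exists_small_le
  have hV (Y : Subtype Q) : V.essImage Y.1 := (hQ _ Y.2).2
  refine ⟨.ofObj fun Y : Subtype Q => (hV Y).witness, inferInstance, fun X hX => ?_⟩
  obtain ⟨Z, hZ, ⟨e⟩⟩ := hQ' (V.obj X) ⟨hX, V.obj_mem_essImage X⟩
  exact ⟨_, ⟨⟨Z, hZ⟩⟩, ⟨V.preimageIso (e ≪≫ (hV ⟨Z, hZ⟩).getIso.symm)⟩⟩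

/-- An equation between the objects of a category: a pair of parallel natural transformations,
which are required to agree. -/
structure Equation (E : Type*) [Category* E] (C₂ : Type*) [Category* C₂] where
  /-- The domain of the two operations. -/
  source : E ⥤ C₂
  /-- The codomain of the two operations. -/
  target : E ⥤ C₂
  /-- The left hand side. -/
  lhs : source ⟶ target
  /-- The right hand side. -/
  rhs : source ⟶ target

namespace Equation

variable {C₂ : Type*} [Category* C₂]

/-- An object satisfies an equation if the two sides agree on it. -/
def Holds (e : Equation E C₂) (Y : E) : Prop :=
  e.lhs.app Y = e.rhs.app Y

theorem lhs_comp_map_eq (e : Equation E C₂) {X Y : E} (hY : e.Holds Y) (f : X ⟶ Y) :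
    e.lhs.app X ≫ e.target.map f = e.rhs.app X ≫ e.target.map f := by
  rw [← e.lhs.naturality, ← e.rhs.naturality, hY]

theorem Holds.of_iso {e : Equation E C₂} {X Y : E} (hX : e.Holds X) (φ : X ≅ Y) : e.Holds Y := by
  rw [Holds, ← cancel_epi (e.source.map φ.hom), e.lhs.naturality, e.rhs.naturality, hX]

theorem holds_of_isColimit (e : Equation E C₂) {J : Type*} [Category* J] {D : J ⥤ E}
    {c : Cocone D} (hc : IsColimit c) [PreservesColimit D e.source]
    (h : ∀ j, e.lhs.app (D.obj j) ≫ e.target.map (c.ι.app j) =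
      e.rhs.app (D.obj j) ≫ e.target.map (c.ι.app j)) : e.Holds c.pt :=
  (isColimitOfPreserves e.source hc).hom_ext fun j => by
    simpa only [Functor.mapCocone_ι_app, NatTrans.naturality] using h j

theorem holds_partialColimit [HasFilteredColimitsOfSize.{v, v} E] (e : Equation E C₂) {T : Type v}
    [PartialOrder T] {κ : Cardinal.{v}} {D : T ⥤ E} {B : DirectedSubset T κ}
    [PreservesColimitsOfShape B.1 e.source]
    (h : ∀ t ∈ B.1, ∃ t' ∈ B.1, ∃ u : t ⟶ t',
      e.lhs.app (D.obj t) ≫ e.target.map (D.map u) =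
        e.rhs.app (D.obj t) ≫ e.target.map (D.map u)) : e.Holds (partialColimit D B) :=
  map_partialColimit_hom_ext fun t ht => by
    obtain ⟨t', ht', u, hu⟩ := h t ht
    rw [e.lhs.naturality, e.rhs.naturality, ← map_comp_partialInclusion D B ht ht' u,
      Functor.map_comp, reassoc_of% hu]

end Equation

variable {C₂ : Type*} [Category.{v} C₂] {Q : Type w} {eqs : Q → Equation E C₂}

section

variable {κ : Cardinal.{v}} [Fact κ.IsRegular] [IsCardinalAccessibleCategory E κ]
  [HasFilteredColimitsOfSize.{v, v} E] (hκ : Cardinal.aleph0 < κ) (hQ : HasCardinalLT Q κ)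
  [∀ e, Functor.IsFinitelyAccessible.{v} (eqs e).source]
  [∀ e, (eqs e).target.IsCardinalAccessible κ]
  (heqs : ∀ e Y, IsCardinalPresentable Y κ → IsCardinalPresentable ((eqs e).source.obj Y) κ)

include hκ hQ heqs in
theorem exists_factorization_holds {X : E} (hX : ∀ e, (eqs e).Holds X) {Z : E}
    [IsCardinalPresentable Z κ] (f : Z ⟶ X) :
    ∃ (Z' : E) (_ : IsCardinalPresentable Z' κ) (g : Z ⟶ Z') (h : Z' ⟶ X), g ≫ h = f ∧
      ∀ e, (eqs e).Holds Z' := by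
  obtain ⟨T, _, _, ⟨p⟩⟩ := exists_poset_colimitPresentation κ X
  have := isFiltered_of_isCardinalFiltered T κ
  have := IsFiltered.isDirectedOrder T
  have : Nonempty T := IsFiltered.nonempty
  have (t : T) : IsCardinalPresentable (p.diag.obj t) κ := p.prop_diag_obj t
  choose next u hnext using fun t =>
    have (e : Q) := heqs e _ (this t)
    exists_forall_comp_map_eq_comp_map p.isColimit hQ (fun e => (eqs e).target) (j := t)
      (fun e => (eqs e).lhs.app (p.diag.obj t)) (fun e => (eqs e).rhs.app (p.diag.obj t))
      fun e => (eqs e).lhs_comp_map_eq (hX e) _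
  obtain ⟨t, g, rfl⟩ := IsCardinalPresentable.exists_hom_of_isColimit κ p.isColimit f
  obtain ⟨B, ht, hB⟩ := DirectedSubset.exists_superset_closed hκ (fun t _ => {next t})
    (fun _ _ => hasCardinalLT_of_finite _ _ hκ.le) (S := {t}) (hasCardinalLT_of_finite _ _ hκ.le)
  refine ⟨partialColimit p.diag B,
    isCardinalPresentable_map_partialColimit (𝟭 E) B p.prop_diag_obj,
    g ≫ partialInclusion p.diag B (ht rfl), coconeDesc p.cocone B,
    (Category.assoc _ _ _).trans
      (congrArg (g ≫ ·) (partialInclusion_comp_coconeDesc p.cocone B _)), fun e => ?_⟩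
  have := preservesColimitsOfShape_directedSubset (eqs e).source B
  exact (eqs e).holds_partialColimit fun t ht => ⟨_, hB t ht t ht rfl, u t, hnext t e⟩

end

variable {V : E' ⥤ E} (hV : ∀ Y, V.essImage Y ↔ ∀ e, (eqs e).Holds Y)

include hV

theorem holds_obj_of_essImage_iff (e : Q) (Y : E') : (eqs e).Holds (V.obj Y) :=
  (hV _).1 (V.obj_mem_essImage Y) e

/-- A full subcategory defined by equations is closed under the colimits which are preserved by
the sources of these equations. -/
noncomputable abbrev createsColimitsOfShapeOfEquations [V.Full] [V.Faithful] (J : Type*)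
    [Category* J] [HasColimitsOfShape J E] [∀ e, PreservesColimitsOfShape J (eqs e).source] :
    CreatesColimitsOfShape J V where
  CreatesColimit {D} :=
    have h : V.essImage (colimit (D ⋙ V)) := (hV _).2 fun e =>
      (eqs e).holds_of_isColimit (colimit.isColimit (D ⋙ V)) fun j =>
        congrArg (· ≫ _) (holds_obj_of_essImage_iff hV e (D.obj j))
    createsColimitOfFullyFaithfulOfIso h.witness h.getIso

theorem hasPresentableEnlargements_of_equations [V.Full] {κ : Cardinal.{v}} [Fact κ.IsRegular]
    [IsCardinalAccessibleCategory E κ] [HasFilteredColimitsOfSize.{v, v} E]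
    (hκ : Cardinal.aleph0 < κ) (hQ : HasCardinalLT Q κ)
    [∀ e, Functor.IsFinitelyAccessible.{v} (eqs e).source]
    [∀ e, (eqs e).target.IsCardinalAccessible κ]
    (heqs : ∀ e Y, IsCardinalPresentable Y κ → IsCardinalPresentable ((eqs e).source.obj Y) κ) :
    HasPresentableEnlargements V κ := by
  intro X K _ Y _ f P _ p g hg
  obtain ⟨Z, hZ, q, h, rfl, hZ'⟩ := exists_factorization_holds hκ hQ heqs
    (fun e => holds_obj_of_essImage_iff hV e X) p
  obtain ⟨Z', ⟨i⟩⟩ := (hV Z).2 hZ'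
  exact ⟨Z', isCardinalPresentable_of_iso i.symm κ, V.preimage (i.hom ≫ h), q ≫ i.inv,
    fun k => V.preimage (g k ≫ q ≫ i.inv), by simp, fun k => by simp⟩

theorem isCardinalAccessibleCategory_of_equations [V.Full] [V.Faithful] {κ : Cardinal.{v}}
    [Fact κ.IsRegular] [IsCardinalAccessibleCategory E κ] [HasFilteredColimitsOfSize.{v, v} E]
    (hκ : Cardinal.aleph0 < κ) (hQ : HasCardinalLT Q κ)
    [∀ e, Functor.IsFinitelyAccessible.{v} (eqs e).source]
    [∀ e, (eqs e).target.IsCardinalAccessible κ]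
    (heqs : ∀ e Y, IsCardinalPresentable Y κ → IsCardinalPresentable ((eqs e).source.obj Y) κ) :
    IsCardinalAccessibleCategory E' κ := by
  have hcreates (J : Type v) [SmallCategory J] [IsCardinalFiltered J κ] :
      HasColimitsOfShape J E' ∧ PreservesColimitsOfShape J V := by
    have := isFiltered_of_isCardinalFiltered J κ
    have (e : Q) := (eqs e).source.isCardinalAccessible_of_le hκ.le
    have (e : Q) := (eqs e).source.preservesColimitsOfShape_of_isCardinalAccessible κ J
    have := createsColimitsOfShapeOfEquations hV J
    exact ⟨hasColimitsOfShape_of_hasColimitsOfShape_createsColimitsOfShape V, inferInstance⟩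
  have : HasCardinalFilteredColimits E' κ := ⟨fun J _ _ => (hcreates J).1⟩
  have : V.IsCardinalAccessible κ := ⟨fun J _ _ => (hcreates J).2⟩
  have := essentiallySmall_inverseImage_of_fullyFaithful V (isCardinalPresentable E κ)
  exact (hasPresentableEnlargements_of_equations hV hκ hQ heqs).isCardinalAccessibleCategory
    fun X (_ : IsCardinalPresentable (V.obj X) κ) => isCardinalPresentable_of_fullyFaithful V κ X

end Equations

section EquationalDialgebras

attribute [local instance] Cardinal.fact_isRegular_aleph0

variable {C : Type u} [Category.{v} C] {C₂ : Type u'} [Category.{v} C₂] {I : Type w}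
  {F G : I → C ⥤ C₂}

namespace Dialgebra

section Accessible

variable {κ : Cardinal.{v}} [Fact κ.IsRegular] [∀ i, (F i).IsCardinalAccessible κ]

instance [HasCardinalFilteredColimits C κ] : HasCardinalFilteredColimits (Dialgebra F G) κ where
  hasColimitsOfShape J _ _ := by
    have := HasCardinalFilteredColimits.hasColimitsOfShape C κ J
    have (i : I) := (F i).preservesColimitsOfShape_of_isCardinalAccessible κ J
    have : CreatesColimitsOfShape J (forget F G) := ⟨inferInstance⟩
    exact hasColimitsOfShape_of_hasColimitsOfShape_createsColimitsOfShape (forget F G)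

instance [HasCardinalFilteredColimits C κ] : (forget F G).IsCardinalAccessible κ where
  preservesColimitOfShape J _ _ := by
    have := HasCardinalFilteredColimits.hasColimitsOfShape C κ J
    have (i : I) := (F i).preservesColimitsOfShape_of_isCardinalAccessible κ J
    have : CreatesColimitsOfShape J (forget F G) := ⟨inferInstance⟩
    infer_instance

end Accessible

variable [HasFilteredColimitsOfSize.{v, v} C] [∀ i, Functor.IsFinitelyAccessible.{v} (F i)]

instance : HasFilteredColimitsOfSize.{v, v} (Dialgebra F G) := by
  rw [← HasCardinalFilteredColimits_iff_hasFilteredColimitsOfSize] at *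
  infer_instance

instance : Functor.IsFinitelyAccessible.{v} (forget F G) := by
  rw [← HasCardinalFilteredColimits_iff_hasFilteredColimitsOfSize] at *
  infer_instance

end Dialgebra

variable {κ : Cardinal.{v}} [Fact κ.IsRegular] [HasFilteredColimitsOfSize.{v, v} C]
  (hκ : Cardinal.aleph0 < κ) (hI : HasCardinalLT I κ)
  [∀ i, Functor.IsFinitelyAccessible.{v} (F i)] [∀ i, (G i).IsCardinalAccessible κ]
  (hF : ∀ i X, IsCardinalPresentable X κ → IsCardinalPresentable ((F i).obj X) κ)

include hκ hI hF

namespace Dialgebra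

theorem inverseImage_forget_le_isCardinalPresentable :
    (isCardinalPresentable C κ).inverseImage (forget F G) ≤
      isCardinalPresentable (Dialgebra F G) κ := by
  intro X (hX : IsCardinalPresentable X.X κ)
  have (i : I) := hF i X.X hX
  have (i : I) := (F i).isCardinalAccessible_of_le hκ.le
  exact isCardinalPresentable_of_X hI X

variable [IsCardinalAccessibleCategory C κ]

theorem isCardinalAccessibleCategory : IsCardinalAccessibleCategory (Dialgebra F G) κ := by
  have (i : I) := (F i).isCardinalAccessible_of_le hκ.le
  have := hI.small
  have := essentiallySmall_inverseImage_forget (F := F) (G := G) (isCardinalPresentable C κ)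
  exact (hasPresentableEnlargements_forget hκ hI hF).isCardinalAccessibleCategory
    (inverseImage_forget_le_isCardinalPresentable hκ hI hF)

theorem isCardinalPresentable_X (X : Dialgebra F G) [IsCardinalPresentable X κ] :
    IsCardinalPresentable X.X κ := by
  have (i : I) := (F i).isCardinalAccessible_of_le hκ.le
  have := hI.small
  have := essentiallySmall_inverseImage_forget (F := F) (G := G) (isCardinalPresentable C κ)
  exact (hasPresentableEnlargements_forget hκ hI hF).isCardinalPresentable_obj
    (inverseImage_forget_le_isCardinalPresentable hκ hI hF) X

end Dialgebra

theorem isCardinalAccessibleCategory_of_equational_dialgebras [IsCardinalAccessibleCategory C κ]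
    {E' : Type*} [Category.{v} E'] {V : E' ⥤ Dialgebra F G} [V.Full] [V.Faithful] {D : Type*}
    [Category.{v} D] {Q : Type*} {eqs : Q → Equation (Dialgebra F G) D} (hQ : HasCardinalLT Q κ)
    (hV : ∀ Y, V.essImage Y ↔ ∀ e, (eqs e).Holds Y)
    [∀ e, Functor.IsFinitelyAccessible.{v} (eqs e).source]
    [∀ e, (eqs e).target.IsCardinalAccessible κ]
    (heqs : ∀ e (Y : Dialgebra F G), IsCardinalPresentable Y.X κ →
      IsCardinalPresentable ((eqs e).source.obj Y) κ) : IsCardinalAccessibleCategory E' κ := by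
  have := Dialgebra.isCardinalAccessibleCategory (G := G) hκ hI hF
  exact isCardinalAccessibleCategory_of_equations hV hκ hQ fun e Y _ =>
    heqs e Y (Dialgebra.isCardinalPresentable_X hκ hI hF Y)

end EquationalDialgebras

section Limits

theorem hasLimitsOfSize_of_isLocallyPresentable (C : Type u) [Category.{v} C]
    [IsLocallyPresentable.{v} C] : HasLimitsOfSize.{v, v} C := by
  obtain ⟨κ, _, _⟩ := IsLocallyPresentable.exists_cardinal.{v} C
  -- `C` is reflective in the presheaves on a small dense subcategory.
  let P := isCardinalPresentable C κ
  let F : SmallModel.{v} P.FullSubcategory ⥤ C :=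
    (equivSmallModel.{v} P.FullSubcategory).inverse ⋙ P.ι
  have : F.IsDense := inferInstance
  have : Reflective (Presheaf.restrictedULiftYoneda.{v} F) :=
    { L := uliftYoneda.{v}.leftKanExtension F
      adj := Presheaf.uliftYonedaAdjunction.{v} _ (uliftYoneda.leftKanExtensionUnit F) }
  exact hasLimits_of_reflective (Presheaf.restrictedULiftYoneda.{v} F)

namespace CommMonLimits

variable {A : Type u} [Category.{v} A] [MonoidalCategory A] [BraidedCategory A]

theorem braiding_mul_comp {M : Mon A} {N : CommMon A} (f : M ⟶ (CommMon.forget₂Mon A).obj N) :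
    ((β_ M.X M.X).hom ≫ μ[M.X]) ≫ f.hom = μ[M.X] ≫ f.hom := by
  have hf := f.isMonHom_hom.mul_hom
  rw [Category.assoc, hf, ← BraidedCategory.braiding_naturality_assoc]
  congr 1
  exact IsCommMonObj.mul_comm N.X

variable {J : Type*} [Category* J] [HasLimitsOfShape J A]

noncomputable instance createsLimitsOfShape_forget₂Mon :
    CreatesLimitsOfShape J (CommMon.forget₂Mon A) where
  CreatesLimit {F} := by
    let L := F ⋙ CommMon.forget₂Mon A
    have : IsCommMonObj (limit L).X :=
      ⟨(isLimitOfPreserves (Mon.forget A) (limit.isLimit L)).hom_ext fun j =>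
        braiding_mul_comp (N := F.obj j) (limit.π L j)⟩
    exact createsLimitOfFullyFaithfulOfIso ⟨(limit L).X⟩ (Iso.refl _)

instance hasLimitsOfShape : HasLimitsOfShape J (CommMon A) :=
  hasLimitsOfShape_of_hasLimitsOfShape_createsLimitsOfShape (CommMon.forget₂Mon A)

end CommMonLimits

end Limits

section FinitelyAccessible

attribute [local instance] Cardinal.fact_isRegular_aleph0

theorem PreservesDirectedColimits.isFinitelyAccessible {C D : Type u} [Category.{v} C]
    [Category.{v} D] {F : C ⥤ D} (hF : PreservesDirectedColimits F) :
    Functor.IsFinitelyAccessible.{v} F where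
  preservesColimitOfShape J _ _ := by
    have := isFiltered_of_isCardinalFiltered J Cardinal.aleph0.{v}
    obtain ⟨T, _, _, _, G, _⟩ := IsFiltered.exists_directed J
    have := hF T
    exact Functor.Final.preservesColimitsOfShape_of_final G F

end FinitelyAccessible

section PointwiseTensor

variable {C : Type*} [Category* C] {D : Type*} [Category* D]

section Shape

variable {J : Type*} [Category* J]

theorem preservesColimitsOfShape_tensor [MonoidalCategory D] [IsSiftedOrEmpty J] (F G : C ⥤ D)
    [PreservesColimitsOfShape J F] [PreservesColimitsOfShape J G]
    [∀ X : D, PreservesColimitsOfShape J (tensorLeft X)]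
    [∀ X : D, PreservesColimitsOfShape J (tensorRight X)] :
    PreservesColimitsOfShape J (F ⊗ G) := by
  have (X : D) : PreservesColimitsOfShape J ((curriedTensor D).obj X) :=
    inferInstanceAs (PreservesColimitsOfShape J (tensorLeft X))
  have (X : D) : PreservesColimitsOfShape J ((curriedTensor D).flip.obj X) :=
    inferInstanceAs (PreservesColimitsOfShape J (tensorRight X))
  refine ⟨fun {K} => ⟨fun {c} hc => ⟨?_⟩⟩⟩
  let L := Functor.diag J ⋙ Functor.uncurry.obj
    ((((Functor.whiskeringLeft₂ D).obj (K ⋙ F)).obj (K ⋙ G)).obj (curriedTensor D))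
  let e : L ≅ K ⋙ (F ⊗ G) :=
    NatIso.ofComponents (fun j => Iso.refl (F.obj (K.obj j) ⊗ G.obj (K.obj j)))
      fun f => by simp [L, MonoidalCategory.tensorHom_def]
  have h := (Functor.Final.isColimitWhiskerEquiv (Functor.diag J) _).symm
    (isColimitOfPreserves₂ (curriedTensor D) (isColimitOfPreserves F hc)
      (isColimitOfPreserves G hc))
  exact IsColimit.equivOfNatIsoOfIso e _ _
    (Cocone.ext (by exact Iso.refl (F.obj c.pt ⊗ G.obj c.pt)) fun j =>
      (Category.comp_id _).trans ((Category.id_comp _).trans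
        (MonoidalCategory.tensorHom_def _ _).symm)) h

open CartesianMonoidalCategory in
theorem preservesLimitsOfShape_tensor [CartesianMonoidalCategory D] (F G : C ⥤ D)
    [PreservesLimitsOfShape J F] [PreservesLimitsOfShape J G] :
    PreservesLimitsOfShape J (F ⊗ G) where
  preservesLimit {K} := ⟨fun {c} hc => by
    have hF := isLimitOfPreserves F hc
    have hG := isLimitOfPreserves G hc
    let sF (s : Cone (K ⋙ (F ⊗ G))) : Cone (K ⋙ F) :=
      (Cone.postcompose (Functor.whiskerLeft K (fst F G))).obj s
    let sG (s : Cone (K ⋙ (F ⊗ G))) : Cone (K ⋙ G) :=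
      (Cone.postcompose (Functor.whiskerLeft K (snd F G))).obj s
    refine ⟨IsLimit.mk (fun s => lift (hF.lift (sF s)) (hG.lift (sG s))) (fun s j => ?_)
      fun s m hm => ?_⟩
    · refine (lift_map _ _ _ _).trans (CartesianMonoidalCategory.hom_ext _ _ ?_ ?_)
      · exact (lift_fst _ _).trans (hF.fac (sF s) j)
      · exact (lift_snd _ _).trans (hG.fac (sG s) j)
    · change s.pt ⟶ F.obj c.pt ⊗ G.obj c.pt at m
      have hm (j : J) : m ≫ (F.map (c.π.app j) ⊗ₘ G.map (c.π.app j)) = s.π.app j := hm j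
      apply CartesianMonoidalCategory.hom_ext
      · refine (hF.uniq (sF s) (m ≫ fst _ _) fun j => ?_).trans (lift_fst _ _).symm
        simp [sF, ← hm]
      · refine (hG.uniq (sG s) (m ≫ snd _ _) fun j => ?_).trans (lift_snd _ _).symm
        simp [sG, ← hm]⟩

end Shape

variable (F G : C ⥤ D) (κ : Cardinal.{w}) [Fact κ.IsRegular]

instance isCardinalAccessible_const (X : D) :
    ((Functor.const C).obj X).IsCardinalAccessible κ where
  preservesColimitOfShape J _ _ := by
    have := isFiltered_of_isCardinalFiltered J κ
    have := IsFiltered.isConnected J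
    exact ⟨fun {_} => ⟨fun {_} _ => ⟨isColimitConstCocone J X⟩⟩⟩

variable [MonoidalCategory D]

instance isCardinalAccessible_tensorUnit : (𝟙_ (C ⥤ D)).IsCardinalAccessible κ :=
  inferInstanceAs (((Functor.const C).obj (𝟙_ D)).IsCardinalAccessible κ)

instance isCardinalAccessible_tensor [F.IsCardinalAccessible κ] [G.IsCardinalAccessible κ]
    [∀ X : D, (tensorLeft X).IsCardinalAccessible κ]
    [∀ X : D, (tensorRight X).IsCardinalAccessible κ] : (F ⊗ G).IsCardinalAccessible κ where
  preservesColimitOfShape J _ _ := by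
    have := isFiltered_of_isCardinalFiltered J κ
    have := IsFilteredOrEmpty.isSiftedOrEmpty (C := J)
    have := F.preservesColimitsOfShape_of_isCardinalAccessible κ J
    have := G.preservesColimitsOfShape_of_isCardinalAccessible κ J
    have (X : D) := (tensorLeft X).preservesColimitsOfShape_of_isCardinalAccessible κ J
    have (X : D) := (tensorRight X).preservesColimitsOfShape_of_isCardinalAccessible κ J
    exact preservesColimitsOfShape_tensor F G

end PointwiseTensor

section CommutativeMonoids

/-- The operations of monoids. -/
inductive MonOp
  | one
  | mul

/-- The equations of commutative monoids. -/
inductive CommMonEq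
  | one_mul
  | mul_one
  | mul_assoc
  | mul_comm

instance : Finite MonOp :=
  Finite.of_surjective (fun b : Bool => if b then .mul else .one) fun
    | .one => ⟨false, rfl⟩
    | .mul => ⟨true, rfl⟩

instance : Finite CommMonEq :=
  Finite.of_surjective ![.one_mul, .mul_one, .mul_assoc, .mul_comm] fun
    | .one_mul => ⟨0, rfl⟩
    | .mul_one => ⟨1, rfl⟩
    | .mul_assoc => ⟨2, rfl⟩
    | .mul_comm => ⟨3, rfl⟩

variable (A : Type u) [Category.{v} A] [MonoidalCategory A]

/-- The arities of the operations of monoids. -/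
def MonOp.source : MonOp → A ⥤ A
  | one => 𝟙_ (A ⥤ A)
  | mul => 𝟭 A ⊗ 𝟭 A

/-- Objects with a unit and a multiplication, without any axioms. -/
abbrev UnitalMagma : Type (max u v) := Dialgebra (MonOp.source A) fun _ => 𝟭 A

namespace UnitalMagma

/-- The underlying object of a unital magma. -/
abbrev forget : UnitalMagma A ⥤ A := Dialgebra.forget (MonOp.source A) fun _ => 𝟭 A

/-- The unit of unital magmas, as a natural transformation. -/
abbrev one : 𝟙_ (UnitalMagma A ⥤ A) ⟶ forget A :=
  Dialgebra.strNatTrans (MonOp.source A) (fun _ => 𝟭 A) MonOp.one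

/-- The multiplication of unital magmas, as a natural transformation. -/
abbrev mul : forget A ⊗ forget A ⟶ forget A :=
  Dialgebra.strNatTrans (MonOp.source A) (fun _ => 𝟭 A) MonOp.mul

end UnitalMagma

variable [BraidedCategory A]

open UnitalMagma in
/-- The equations of commutative monoids, as equations between natural transformations: the unit
and the multiplication make the forgetful functor of unital magmas a unital magma in the monoidal
category of functors, with the pointwise tensor product. -/
abbrev CommMonEq.toEquation : CommMonEq → Equation (UnitalMagma A) A
  | one_mul => ⟨𝟙_ _ ⊗ forget A, forget A, one A ▷ forget A ≫ mul A, (λ_ (forget A)).hom⟩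
  | mul_one => ⟨forget A ⊗ 𝟙_ _, forget A, forget A ◁ one A ≫ mul A, (ρ_ (forget A)).hom⟩
  | mul_assoc =>
    ⟨(forget A ⊗ forget A) ⊗ forget A, forget A, mul A ▷ forget A ≫ mul A,
      (α_ (forget A) (forget A) (forget A)).hom ≫ forget A ◁ mul A ≫ mul A⟩
  | mul_comm =>
    ⟨forget A ⊗ forget A, forget A, (β_ (forget A) (forget A)).hom ≫ mul A, mul A⟩

/-- The underlying unital magma of a commutative monoid. -/
def UnitalMagma.ofCommMon : CommMon A ⥤ UnitalMagma A where
  obj M :=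
    { X := M.X
      str
        | .one => η[M.X]
        | .mul => μ[M.X] }
  map f :=
    { hom := f.hom.hom
      comm
        | .one => (IsMonHom.one_hom f.hom.hom).trans (Category.id_comp _).symm
        | .mul => IsMonHom.mul_hom f.hom.hom }

variable {A}

namespace UnitalMagma

theorem isMonHom_hom {M N : CommMon A} (f : (ofCommMon A).obj M ⟶ (ofCommMon A).obj N) :
    IsMonHom (M := M.X) (N := N.X) f.hom :=
  ⟨(f.comm .one).trans (Category.id_comp _), f.comm .mul⟩

instance : (ofCommMon A).Faithful where
  map_injective h := CommMon.hom_ext _ _ (congrArg Dialgebra.Hom.hom h)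

instance : (ofCommMon A).Full where
  map_surjective {M N} f :=
    ⟨CommMon.homMk (Mon.Hom.mk (M := M.toMon) (N := N.toMon) f.hom
      (isMonHom_hom := isMonHom_hom f)), rfl⟩

theorem holds_ofCommMon_obj (M : CommMon A) :
    ∀ e : CommMonEq, (e.toEquation A).Holds ((ofCommMon A).obj M)
  | .one_mul => MonObj.one_mul M.X
  | .mul_one => MonObj.mul_one M.X
  | .mul_assoc => MonObj.mul_assoc M.X
  | .mul_comm => IsCommMonObj.mul_comm M.X

theorem essImage_ofCommMon_iff (X : UnitalMagma A) :
    (ofCommMon A).essImage X ↔ ∀ e : CommMonEq, (e.toEquation A).Holds X := by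
  refine ⟨fun ⟨M, ⟨φ⟩⟩ e => (holds_ofCommMon_obj M e).of_iso φ, fun h => ?_⟩
  · let : MonObj X.X :=
      { one := X.str .one
        mul := X.str .mul
        one_mul := h .one_mul
        mul_one := h .mul_one
        mul_assoc := h .mul_assoc }
    have : IsCommMonObj X.X := ⟨h .mul_comm⟩
    refine ⟨⟨X.X⟩, ⟨Dialgebra.isoMk (Iso.refl X.X) fun i => ?_⟩⟩
    cases i with
    | one => exact (Category.comp_id _).trans (Category.id_comp _).symm
    | mul =>
      exact (Category.comp_id _).trans
        ((congrArg (· ≫ X.str .mul) (id_tensorHom_id _ _)).trans (Category.id_comp _)).symm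

end UnitalMagma

section LocallyPresentable

attribute [local instance] Cardinal.fact_isRegular_aleph0

variable [∀ X : A, Functor.IsFinitelyAccessible.{v} (tensorLeft X)]
  [∀ X : A, Functor.IsFinitelyAccessible.{v} (tensorRight X)]

instance MonOp.isFinitelyAccessible_source :
    ∀ i : MonOp, Functor.IsFinitelyAccessible.{v} (i.source A)
  | one => isCardinalAccessible_tensorUnit Cardinal.aleph0
  | mul => isCardinalAccessible_tensor _ _ Cardinal.aleph0

instance CommMonEq.isFinitelyAccessible_source [HasFilteredColimitsOfSize.{v, v} A] :
    ∀ e : CommMonEq, Functor.IsFinitelyAccessible.{v} (e.toEquation A).source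
  | one_mul => isCardinalAccessible_tensor _ _ Cardinal.aleph0
  | mul_one => isCardinalAccessible_tensor _ _ Cardinal.aleph0
  | mul_assoc => isCardinalAccessible_tensor _ _ Cardinal.aleph0
  | mul_comm => isCardinalAccessible_tensor _ _ Cardinal.aleph0

theorem isLocallyPresentable_commMon [IsLocallyPresentable.{v} A] :
    IsLocallyPresentable.{v} (CommMon A) := by
  have := hasLimitsOfSize_of_isLocallyPresentable A
  have : HasLimitsOfSize.{v, v} (CommMon A) := ⟨fun _ _ => inferInstance⟩
  obtain ⟨κA, _, _⟩ := IsLocallyPresentable.exists_cardinal.{v} A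
  obtain ⟨κt, htensor⟩ := exists_cardinal_isCardinalPresentable_tensor (A := A)
  obtain ⟨κu, hunit⟩ := exists_cardinal_forall_isCardinalPresentable fun _ : Unit => 𝟙_ A
  refine isLocallyPresentable_of_isCardinalAccessibleCategory fun κ₀ => ?_
  let κ := Order.succ (max Cardinal.aleph0 (max κ₀ (max κA (max κt κu))))
  have hκ : Cardinal.aleph0 < κ := Order.lt_succ_of_le (le_max_left _ _)
  have : Fact κ.IsRegular := ⟨Cardinal.isRegular_succ (le_max_left _ _)⟩
  obtain ⟨h₀, hA, ht, hu⟩ : κ₀ ≤ κ ∧ κA ≤ κ ∧ κt ≤ κ ∧ κu ≤ κ := by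
    simpa using ((le_max_right Cardinal.aleph0 _).trans (Order.le_succ _) : _ ≤ κ)
  have := IsCardinalLocallyPresentable.of_le A hA
  have hsource : ∀ (i : MonOp) (X : A), IsCardinalPresentable X κ →
      IsCardinalPresentable ((i.source A).obj X) κ
    | .one, _, _ => hunit κ hu ()
    | .mul, X, hX => htensor κ ht hκ X X hX hX
  have hsource' : ∀ (e : CommMonEq) (X : UnitalMagma A), IsCardinalPresentable X.X κ →
      IsCardinalPresentable ((e.toEquation A).source.obj X) κ
    | .one_mul, X, hX => htensor κ ht hκ _ X.X (hunit κ hu ()) hX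
    | .mul_one, X, hX => htensor κ ht hκ X.X _ hX (hunit κ hu ())
    | .mul_assoc, X, hX => htensor κ ht hκ _ X.X (htensor κ ht hκ X.X X.X hX hX) hX
    | .mul_comm, X, hX => htensor κ ht hκ X.X X.X hX hX
  have htarget : ∀ e : CommMonEq, (e.toEquation A).target.IsCardinalAccessible κ
    | .one_mul | .mul_one | .mul_assoc | .mul_comm =>
      (UnitalMagma.forget A).isCardinalAccessible_of_le hκ.le
  exact ⟨κ, inferInstance, h₀, isCardinalAccessibleCategory_of_equational_dialgebras hκ
    (hasCardinalLT_of_finite _ _ hκ.le) hsource (hasCardinalLT_of_finite _ _ hκ.le)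
    UnitalMagma.essImage_ofCommMon_iff hsource'⟩

end LocallyPresentable

end CommutativeMonoids

section CartesianFunctors

open CartesianMonoidalCategory

variable {C D : Type*} [Category* C] [Category* D] [CartesianMonoidalCategory D] {F G H K : C ⥤ D}

theorem lift_app (f : F ⟶ G) (g : F ⟶ H) (X : C) :
    (lift f g).app X = lift (f.app X) (g.app X) :=
  CartesianMonoidalCategory.hom_ext _ _
    ((NatTrans.congr_app (lift_fst f g) X).trans (lift_fst _ _).symm)
    ((NatTrans.congr_app (lift_snd f g) X).trans (lift_snd _ _).symm)

theorem lift_comp_app_eq_toUnit_comp_app_iff (f : F ⟶ G) (g : F ⟶ H) (m : G ⊗ H ⟶ K)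
    (e : 𝟙_ (C ⥤ D) ⟶ K) (X : C) :
    (lift f g ≫ m).app X = (toUnit F ≫ e).app X ↔
      lift (f.app X) (g.app X) ≫ m.app X = toUnit (F.obj X) ≫ e.app X := by
  rw [NatTrans.comp_app, NatTrans.comp_app, lift_app]
  exact Eq.congr_right (congrArg (· ≫ e.app X) (toUnit_unique _ _))

end CartesianFunctors

section Cogroups

/-- The operations of groups. -/
inductive GrpOp
  | one
  | mul
  | inv

/-- The equations of groups. -/
inductive GrpEq
  | one_mul
  | mul_one
  | mul_assoc
  | left_inv
  | right_inv

instance : Finite GrpOp :=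
  Finite.of_surjective ![.one, .mul, .inv] fun
    | .one => ⟨0, rfl⟩
    | .mul => ⟨1, rfl⟩
    | .inv => ⟨2, rfl⟩

instance : Finite GrpEq :=
  Finite.of_surjective ![.one_mul, .mul_one, .mul_assoc, .left_inv, .right_inv] fun
    | .one_mul => ⟨0, rfl⟩
    | .mul_one => ⟨1, rfl⟩
    | .mul_assoc => ⟨2, rfl⟩
    | .left_inv => ⟨3, rfl⟩
    | .right_inv => ⟨4, rfl⟩

variable (M : Type u) [Category.{v} M] [CartesianMonoidalCategory Mᵒᵖ]

/-- The coarities of the cooperations of cogroups. -/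
def GrpOp.target : GrpOp → M ⥤ M
  | one => (𝟙_ (Mᵒᵖ ⥤ Mᵒᵖ)).unop
  | mul => (𝟭 Mᵒᵖ ⊗ 𝟭 Mᵒᵖ).unop
  | inv => 𝟭 M

/-- Objects with a counit, a comultiplication and an antipode, without any axioms. -/
abbrev Precogroup : Type (max u v) := Dialgebra (fun _ => 𝟭 M) (GrpOp.target M)

namespace Precogroup

/-- The contravariant underlying object of a precogroup. -/
abbrev opForget : (Precogroup M)ᵒᵖ ⥤ Mᵒᵖ := (Dialgebra.forget (fun _ => 𝟭 M) (GrpOp.target M)).op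

/-- The counit of precogroups, as a natural transformation between contravariant functors. -/
abbrev one : 𝟙_ ((Precogroup M)ᵒᵖ ⥤ Mᵒᵖ) ⟶ opForget M :=
  NatTrans.op (Dialgebra.strNatTrans (fun _ => 𝟭 M) (GrpOp.target M) GrpOp.one)

/-- The comultiplication of precogroups, as a natural transformation between contravariant
functors. -/
abbrev mul : opForget M ⊗ opForget M ⟶ opForget M :=
  NatTrans.op (Dialgebra.strNatTrans (fun _ => 𝟭 M) (GrpOp.target M) GrpOp.mul)

/-- The antipode of precogroups, as a natural transformation between contravariant functors. -/
abbrev inv : opForget M ⟶ opForget M :=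
  NatTrans.op (Dialgebra.strNatTrans (fun _ => 𝟭 M) (GrpOp.target M) GrpOp.inv)

end Precogroup

/-- A pair of parallel natural transformations between contravariant functors, as an equation. -/
abbrev Equation.ofOp {C D : Type*} [Category* C] [Category* D] {F G : Cᵒᵖ ⥤ Dᵒᵖ}
    (f g : F ⟶ G) : Equation C D :=
  ⟨G.unop, F.unop, NatTrans.unop f, NatTrans.unop g⟩

open Precogroup CartesianMonoidalCategory in
/-- The equations of cogroups. -/
abbrev GrpEq.toEquation : GrpEq → Equation (Precogroup M) M
  | one_mul => .ofOp (one M ▷ opForget M ≫ mul M) (λ_ (opForget M)).hom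
  | mul_one => .ofOp (opForget M ◁ one M ≫ mul M) (ρ_ (opForget M)).hom
  | mul_assoc => .ofOp (mul M ▷ opForget M ≫ mul M)
      ((α_ (opForget M) (opForget M) (opForget M)).hom ≫ opForget M ◁ mul M ≫ mul M)
  | left_inv => .ofOp (lift (inv M) (𝟙 (opForget M)) ≫ mul M) (toUnit (opForget M) ≫ one M)
  | right_inv => .ofOp (lift (𝟙 (opForget M)) (inv M) ≫ mul M) (toUnit (opForget M) ≫ one M)

/-- The underlying precogroup of a cogroup. -/
def Precogroup.ofCogroup : (Grp Mᵒᵖ)ᵒᵖ ⥤ Precogroup M where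
  obj X :=
    { X := X.unop.X.unop
      str
        | .one => η[X.unop.X].unop
        | .mul => μ[X.unop.X].unop
        | .inv => ι[X.unop.X].unop }
  map f :=
    { hom := f.unop.hom.hom.unop
      comm
        | .one => (Category.comp_id _).trans
            (congrArg Quiver.Hom.unop (IsMonHom.one_hom f.unop.hom.hom)).symm
        | .mul => congrArg Quiver.Hom.unop (IsMonHom.mul_hom f.unop.hom.hom).symm
        | .inv => congrArg Quiver.Hom.unop (GrpObj.inv_hom f.unop.hom.hom).symm }

variable {M}

namespace Precogroup

theorem isMonHom_hom_op {X Y : (Grp Mᵒᵖ)ᵒᵖ} (f : (ofCogroup M).obj X ⟶ (ofCogroup M).obj Y) :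
    IsMonHom (M := Y.unop.X) (N := X.unop.X) f.hom.op where
  one_hom := Quiver.Hom.unop_inj ((f.comm .one).symm.trans (Category.comp_id _))
  mul_hom := Quiver.Hom.unop_inj (f.comm .mul).symm

instance : (ofCogroup M).Faithful where
  map_injective h := Quiver.Hom.unop_inj (Grp.hom_ext _ _
    (Quiver.Hom.unop_inj (congrArg Dialgebra.Hom.hom h)))

instance : (ofCogroup M).Full where
  map_surjective {X Y} f :=
    ⟨(have := isMonHom_hom_op f; Grp.homMk (A := Y.unop) (B := X.unop) f.hom.op).op, rfl⟩

theorem holds_ofCogroup_obj (X : (Grp Mᵒᵖ)ᵒᵖ) :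
    ∀ e : GrpEq, (e.toEquation M).Holds ((ofCogroup M).obj X)
  | .one_mul => congrArg Quiver.Hom.unop (MonObj.one_mul X.unop.X)
  | .mul_one => congrArg Quiver.Hom.unop (MonObj.mul_one X.unop.X)
  | .mul_assoc => congrArg Quiver.Hom.unop (MonObj.mul_assoc X.unop.X)
  | .left_inv => congrArg Quiver.Hom.unop
      ((lift_comp_app_eq_toUnit_comp_app_iff (inv M) (𝟙 (opForget M)) (mul M) (one M) _).2
        (GrpObj.left_inv X.unop.X))
  | .right_inv => congrArg Quiver.Hom.unop
      ((lift_comp_app_eq_toUnit_comp_app_iff (𝟙 (opForget M)) (inv M) (mul M) (one M) _).2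
        (GrpObj.right_inv X.unop.X))

theorem essImage_ofCogroup_iff (X : Precogroup M) :
    (ofCogroup M).essImage X ↔ ∀ e : GrpEq, (e.toEquation M).Holds X := by
  refine ⟨fun ⟨Y, ⟨φ⟩⟩ e => (holds_ofCogroup_obj Y e).of_iso φ, fun h => ?_⟩
  let : GrpObj (op X.X) :=
    { one := (X.str .one).op
      mul := (X.str .mul).op
      one_mul := congrArg Quiver.Hom.op (h .one_mul)
      mul_one := congrArg Quiver.Hom.op (h .mul_one)
      mul_assoc := congrArg Quiver.Hom.op (h .mul_assoc)
      inv := (X.str .inv).op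
      left_inv := (lift_comp_app_eq_toUnit_comp_app_iff (inv M) (𝟙 (opForget M)) (mul M) (one M)
        (op X)).1 (congrArg Quiver.Hom.op (h .left_inv))
      right_inv := (lift_comp_app_eq_toUnit_comp_app_iff (𝟙 (opForget M)) (inv M) (mul M) (one M)
        (op X)).1 (congrArg Quiver.Hom.op (h .right_inv)) }
  refine ⟨op ⟨op X.X⟩, ⟨Dialgebra.isoMk (Iso.refl X.X) fun i =>
    .trans ?_ (Category.id_comp _).symm⟩⟩
  cases i with
  | one => exact Category.comp_id _
  | mul =>
    exact Quiver.Hom.op_inj ((congrArg (· ≫ (X.str .mul).op) (id_tensorHom_id _ _)).trans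
      (Category.id_comp _))
  | inv => exact Category.comp_id _

end Precogroup

section Accessible

section Unop

variable {C D : Type*} [Category* C] [Category* D] [CartesianMonoidalCategory Dᵒᵖ]
  (κ : Cardinal.{w}) [Fact κ.IsRegular]

instance isCardinalAccessible_unop_tensor (F G : Cᵒᵖ ⥤ Dᵒᵖ) [F.unop.IsCardinalAccessible κ]
    [G.unop.IsCardinalAccessible κ] : (F ⊗ G).unop.IsCardinalAccessible κ where
  preservesColimitOfShape J _ _ := by
    have : IsCardinalFiltered Jᵒᵖᵒᵖ κ := .of_equivalence κ (opOpEquivalence J).symm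
    have := F.unop.preservesColimitsOfShape_of_isCardinalAccessible κ Jᵒᵖᵒᵖ
    have := G.unop.preservesColimitsOfShape_of_isCardinalAccessible κ Jᵒᵖᵒᵖ
    have : PreservesLimitsOfShape Jᵒᵖ F := preservesLimitsOfShape_op Jᵒᵖ F.unop
    have : PreservesLimitsOfShape Jᵒᵖ G := preservesLimitsOfShape_op Jᵒᵖ G.unop
    have := preservesLimitsOfShape_tensor (J := Jᵒᵖ) F G
    exact preservesColimitsOfShape_unop J (F ⊗ G)

instance isCardinalAccessible_unop_tensorUnit : (𝟙_ (Cᵒᵖ ⥤ Dᵒᵖ)).unop.IsCardinalAccessible κ :=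
  inferInstanceAs (((Functor.const C).obj (𝟙_ Dᵒᵖ).unop).IsCardinalAccessible κ)

end Unop

variable (κ : Cardinal.{v}) [Fact κ.IsRegular]

instance GrpOp.isCardinalAccessible_target : ∀ i : GrpOp, (i.target M).IsCardinalAccessible κ
  | one => isCardinalAccessible_unop_tensorUnit κ
  | mul =>
    have : (𝟭 Mᵒᵖ).unop.IsCardinalAccessible κ := inferInstanceAs ((𝟭 M).IsCardinalAccessible κ)
    isCardinalAccessible_unop_tensor κ (𝟭 Mᵒᵖ) (𝟭 Mᵒᵖ)
  | inv => inferInstanceAs ((𝟭 M).IsCardinalAccessible κ)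

instance Precogroup.isCardinalAccessible_unop_opForget [HasCardinalFilteredColimits M κ] :
    (opForget M).unop.IsCardinalAccessible κ :=
  inferInstanceAs ((Dialgebra.forget (fun _ => 𝟭 M) (GrpOp.target M)).IsCardinalAccessible κ)

instance GrpEq.isCardinalAccessible_target [HasCardinalFilteredColimits M κ] :
    ∀ e : GrpEq, (e.toEquation M).target.IsCardinalAccessible κ
  | one_mul => isCardinalAccessible_unop_tensor κ _ _
  | mul_one => isCardinalAccessible_unop_tensor κ _ _
  | mul_assoc => isCardinalAccessible_unop_tensor κ (_ ⊗ _) _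
  | left_inv => Precogroup.isCardinalAccessible_unop_opForget κ
  | right_inv => Precogroup.isCardinalAccessible_unop_opForget κ

end Accessible

theorem isLocallyPresentable_cogroup [IsLocallyPresentable.{v} M] :
    IsLocallyPresentable.{v} (Grp Mᵒᵖ)ᵒᵖ := by
  obtain ⟨κM, _, _⟩ := IsLocallyPresentable.exists_cardinal.{v} M
  have : HasLimitsOfSize.{v, v} (Grp Mᵒᵖ) := ⟨fun _ _ => inferInstance⟩
  have (e : GrpEq) : Functor.IsFinitelyAccessible.{v} (e.toEquation M).source := by
    cases e <;>
      exact inferInstanceAs (Dialgebra.forget (fun _ => 𝟭 M) (GrpOp.target M)).IsFinitelyAccessible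
  let κ := Order.succ (max Cardinal.aleph0 κM)
  have hκ : Cardinal.aleph0 < κ := Order.lt_succ_of_le (le_max_left _ _)
  have : Fact κ.IsRegular := ⟨Cardinal.isRegular_succ (le_max_left _ _)⟩
  have := IsCardinalLocallyPresentable.of_le M ((le_max_right _ κM).trans (Order.le_succ _) : _ ≤ κ)
  have : IsCardinalAccessibleCategory (Grp Mᵒᵖ)ᵒᵖ κ :=
    isCardinalAccessibleCategory_of_equational_dialgebras (eqs := GrpEq.toEquation M) hκ
      (hasCardinalLT_of_finite _ _ hκ.le) (fun _ _ hX => hX) (hasCardinalLT_of_finite _ _ hκ.le)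
      Precogroup.essImage_ofCogroup_iff (fun e _ hY => by cases e <;> exact hY)
  exact ⟨κ, inferInstance, {}⟩

end Cogroups

section Protomodular

variable {D : Type u} [Category.{v} D]

theorem IsProtomodular.opOp (hD : IsProtomodular D) : IsProtomodular Dᵒᵖᵒᵖ where
  hasPullback X Y B r s f hsr := by
    have := hD.hasPullback r.unop.unop s.unop.unop f.unop.unop
      (congrArg (fun g => g.unop.unop) hsr)
    exact (IsPullback.of_hasPullback r.unop.unop f.unop.unop).op.op.hasPullback
  jointlyExtremalEpic X Y B P r s f k t hsr h W m s' k' hm hs hk := by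
    have := hD.jointlyExtremalEpic r.unop.unop s.unop.unop f.unop.unop k.unop.unop t.unop.unop
      (congrArg (fun g => g.unop.unop) hsr) h.unop.unop m.unop.unop s'.unop.unop k'.unop.unop
      inferInstance (congrArg (fun g => g.unop.unop) hs) (congrArg (fun g => g.unop.unop) hk)
    have := (isIso_unop_iff m.unop).1 this
    exact (isIso_unop_iff m).1 this

variable [CartesianMonoidalCategory D]

/-- On generalized elements, `x = (x / s (r x)) * s (r x)`, where the first factor lies in the
kernel of `r`, hence in the image of `k`, and the second one in the image of `s`. -/
theorem isSplitEpi_of_factors_section_of_factors_pullback {X Y B P W : D} [GrpObj X] [GrpObj Y]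
    [MonObj B] [MonObj W] {r : X ⟶ Y} {s : Y ⟶ X} {f : B ⟶ Y} {k : P ⟶ X} {t : P ⟶ B}
    [IsMonHom r] [IsMonHom f] (hsr : s ≫ r = 𝟙 Y) (h : IsPullback k t r f) (m : W ⟶ X)
    [IsMonHom m] (s' : Y ⟶ W) (k' : P ⟶ W) (hs : s' ≫ m = s) (hk : k' ≫ m = k) :
    IsSplitEpi m := by
  have hd : (𝟙 X / (r ≫ s)) ≫ r = (1 : X ⟶ B) ≫ f := by
    rw [GrpObj.div_comp, MonObj.one_comp, Category.assoc, hsr, Category.id_comp, Category.comp_id,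
      div_self']
  refine ⟨⟨⟨(h.lift _ _ hd ≫ k') * (r ≫ s'), ?_⟩⟩⟩
  rw [MonObj.mul_comp, Category.assoc, Category.assoc, hk, hs, h.lift_fst, div_mul_cancel]

theorem IsProtomodular.grp [HasPullbacks D] : IsProtomodular (Grp D) where
  hasPullback _ _ _ _ _ _ _ := inferInstance
  jointlyExtremalEpic X Y B P r s f k t hsr h W m s' k' _ hs hk := by
    let U := Grp.forget D
    have : IsSplitEpi (U.map m) :=
      isSplitEpi_of_factors_section_of_factors_pullback (X := X.X) (Y := Y.X) (B := B.X)
        (W := W.X) (r := r.hom.hom) (f := f.hom.hom) (congrArg U.map hsr) (h.map U) m.hom.hom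
        (U.map s') (U.map k') (congrArg U.map hs) (congrArg U.map hk)
    have : IsIso (U.map m) := isIso_of_mono_of_isSplitEpi _
    have : U.ReflectsIsomorphisms :=
      inferInstanceAs ((Grp.forget₂Mon D ⋙ Mon.forget D).ReflectsIsomorphisms)
    exact isIso_of_reflects_iso m U

end Protomodular

theorem proposition3p1 (A : Type u) [Category.{v} A] [MonoidalCategory A] [SymmetricCategory A]
    (hA : IsLocallyPresentable.{v} A)
    (hleft : ∀ X : A, PreservesDirectedColimits (tensorLeft X))
    (hright : ∀ X : A, PreservesDirectedColimits (tensorRight X)) :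
    IsLocallyPresentable.{v} (CommHopf A) ∧
      HasZeroObject (CommHopf A) ∧
      IsProtomodular (CommHopf A)ᵒᵖ := by
  have (X : A) := (hleft X).isFinitelyAccessible
  have (X : A) := (hright X).isFinitelyAccessible
  have : IsLocallyPresentable.{v} (CommMon A) := isLocallyPresentable_commMon
  have : HasPullbacks (CommMon A)ᵒᵖ := by
    obtain ⟨κ, _, _⟩ := IsLocallyPresentable.exists_cardinal.{v} (CommMon A)
    have : HasColimitsOfSize.{0, 0} (CommMon A) := hasColimitsOfSizeShrink.{0, 0, v, v} _
    infer_instance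
  exact ⟨isLocallyPresentable_cogroup, inferInstance, IsProtomodular.grp.opOp⟩
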